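/- Notation. Let $\operatorname{Im}\tau>0$, $q^a:=e^{2\pi i\tau a}$, $z_1,z_2,t\in\mathbb C$. For $m\in\frac12\mathbb Z_{>0}$, $s\in\frac12\mathbb Z$ put $$\Phi^{[m,s]}(\tau,z_1,z_2,t)=e^{-2\pi imt}\Big(\sum_{j\in\mathbb Z}\frac{e^{2\pi imj(z_1+z_2)+2\pi isz_1}q^{mj^2+sj}}{1-e^{2\pi iz_1}q^j}-\sum_{j\in\mathbb Z}\frac{e^{-2\pi imj(z_1+z_2)-2\pi isz_2}q^{mj^2+sj}}{1-e^{-2\pi iz_2}q^j}\Big),$$ which is defined for $z_1,z_2\notin\mathbb Z+\mathbb Z\tau$. Let $$\theta_{k,m}(\tau,z)=\sum_{j\in\mathbb Z}e^{2\pi im(j+\frac k{2m})z}q^{m(j+\frac k{2m})^2},\qquad \theta^{(-)}_{k,m}(\tau,z)=\sum_{j\in\mathbb Z}(-1)^je^{2\pi im(j+\frac k{2m})z}q^{m(j+\frac k{2m})^2},$$ let $D_{k,m}:=\theta_{k,m}-\theta_{-k,m}$, $\vartheta_{11}(\tau,z)=\sum_{n\in\mathbb Z}e^{\pi i\tau(n+\frac12)^2+2\pi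 i(n+\frac12)(z+\frac12)}$, let $\eta$ be the Dedekind eta function, and $E(w):=e^w+e^{-w}$. Write $d=z_1-z_2$, $u=z_1+z_2$. For $m\in\frac12\mathbb Z_{>0}$ define $$H_m(\tau,z_1,z_2)=\frac{1}{\theta^{(-)}_{0,2m+1}\big(\tau,\frac{2md}{2m+1}\big)}\Big[-i\eta(2\tau)^3\Big\{\frac{\theta^{(-)}_{0,2m+1}(\tau,\frac d{2m+1}+u)}{\vartheta_{11}(2\tau,2z_1)}+\frac{\theta^{(-)}_{0,2m+1}(\tau,\frac d{2m+1}-u)}{\vartheta_{11}(2\tau,2z_2)}\Big\}+\sum_{j\ge1}h_j\Big],$$ $$h_j=\sum_{r=1}^j\sum_{\substack{1\le k\le 2m-1\\k\text{ odd}}}(-1)^jq^{(2m+1)j^2-\frac{(4m(j-r)+k)^2}{8m}}E(\pi i(4mr-k)d)\,D_{k,2m}(\tau,u)$$ $$\qquad-\sum_{r=0}^{j-1}\sum_{\substack{1\le k\le 2m-1\\k\text{ odd}}}(-1)^jq^{(2m+1)j^2-\frac{(4m(j-r)-k)^2}{8m}}E(\pi i(4mr+k)d)\,D_{k,2m}(\tau,u).$$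 For $m\in\frac12+\mathbb Z_{\ge0}$ define $$G_m(\tau,z_1,z_2)=\frac{1}{\theta^{(-)}_{-2m,2m+1}\big(\tau,\frac{2md}{2m+1}\big)}\Big[-i\eta(2\tau)^3\Big\{\frac{\theta^{(-)}_{2m,2m+1}(\tau,\frac d{2m+1}+u)}{\vartheta_{11}(2\tau,2z_1)}+\frac{\theta^{(-)}_{2m,2m+1}(\tau,\frac d{2m+1}-u)}{\vartheta_{11}(2\tau,2z_2)}\Big\}+q^{-\frac m{2(2m+1)}}e^{\frac{2\pi imd}{2m+1}}\sum_{j\ge1}g_j\Big]$$ $$\qquad+\sum_{k=1}^{m-1/2}e^{2\pi ikd}q^{-\frac{k^2}{2m}}D_{k,m}(2\tau,2u),$$ $$g_j=-\sum_{r=1}^j\sum_{\substack{0\le k\le 2m-1\\k\text{ even}}}(-1)^jq^{(2m+1)j^2-\frac{(4m(j-r)+2m-k)^2}{8m}}E(\pi i(4mr-2m+k)(d-\tau))\,D_{k,2m}(\tau,u)$$ $$\qquad+\sum_{r=0}^{j-1}\sum_{\substack{0\le k\le 2m-1\\k\text{ even}}}(-1)^jq^{(2m+1)j^2-\frac{(4m(j-r)-2m+k)^2}{8m}}E(\pi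 i(4mr+2m-k)(d-\tau))\,D_{k,2m}(\tau,u).$$ Given $m\in\frac12\mathbb Z_{>0}$ and $s\in\frac12\mathbb Z$, write $s=s_0+n$ with $s_0\in\{0,\frac12\}$, $n\in\mathbb Z$, and put $B_{m,\frac12}(\tau,z_1,z_2)=H_m(\frac\tau2,\frac{z_1}2,\frac{z_2}2)$ and, with $m=2^pm_0$, $p\ge0$, $m_0\in\frac12+\mathbb Z_{\ge0}$, $$B_{m,0}(\tau,z_1,z_2)=G_{m_0}(2^{p-1}\tau,2^{p-1}z_1,2^{p-1}z_2)+\sum_{i=0}^{p-1}H_{m/2^{i+1}}(2^i\tau,2^iz_1,2^iz_2).$$ Finally, with $\sigma_k(\tau,z_1,z_2)=e^{\pi i(s_0+k)d}q^{-\frac{(s_0+k)^2}{4m}}D_{s_0+k,m}(\tau,u)$, put $$F^{[m,s]}(\tau,z_1,z_2,t)=e^{-2\pi imt}\Big(B_{m,s_0}(\tau,z_1,z_2)-\sum_{0\le k<n}\sigma_k(\tau,z_1,z_2)+\sum_{n\le k<0}\sigma_k(\tau,z_1,z_2)\Big).$$ Proposition. Let $m\in\frac12\mathbb Z_{>0}$,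 $s\in\frac12\mathbb Z$ and $\operatorname{Im}\tau>0$. The two series defining $\Phi^{[m,s]}$ converge absolutely whenever $z_1,z_2\notin\mathbb Z+\mathbb Z\tau$, and the series $\sum_jh_j$ (and $\sum_jg_j$ if $m\in\frac12+\mathbb Z$) converge absolutely for all $z_1,z_2$. The set $U\subset\mathbb C^2$ of the $(z_1,z_2)$ at which none of the denominators occurring in $F^{[m,s]}$ (values of $\theta^{(-)}$ and $\vartheta_{11}$) vanishes is dense. If $(z_1,z_2)\in U$, then $z_1,z_2\notin\mathbb Z+\mathbb Z\tau$ and for all $t\in\mathbb C$ $$\Phi^{[m,s]}(\tau,z_1,z_2,t)=F^{[m,s]}(\tau,z_1,z_2,t).$$ For arbitrary $z_1,z_2\notin\mathbb Z+\mathbb Z\tau$ and $t\in\mathbb C$, $\Phi^{[m,s]}(\tau,z_1,z_2,t)$ is the limit of $F^{[m,s]}(\tau,w_1,w_2,t)$ as $(w_1,w_2)\to(z_1,z_2)$ within $U$. -/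

import Mathlib

open Complex Filter Topology

namespace MockTheta

noncomputable section

/-- The power `q ^ a = e ^ (2 π i τ a)` of `q = e ^ (2 π i τ)`. -/
def qPow (τ a : ℂ) : ℂ := cexp (2 * (Real.pi : ℂ) * I * τ * a)

/-! ### The mock theta functions -/

/-- The `j`-th term of the series for `Φ₁^{[m,s]}`. -/
def phi1Term (m s τ z₁ z₂ : ℂ) (j : ℤ) : ℂ :=
  cexp (2 * (Real.pi : ℂ) * I * m * j * (z₁ + z₂) + 2 * (Real.pi : ℂ) * I * s * z₁)
      * qPow τ (m * (j : ℂ) ^ 2 + s * j)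
    / (1 - cexp (2 * (Real.pi : ℂ) * I * z₁) * qPow τ j)

/-- The `j`-th term of the series for `Φ₂^{[m,s]}`. -/
def phi2Term (m s τ z₁ z₂ : ℂ) (j : ℤ) : ℂ :=
  cexp (-(2 * (Real.pi : ℂ) * I * m * j * (z₁ + z₂)) - 2 * (Real.pi : ℂ) * I * s * z₂)
      * qPow τ (m * (j : ℂ) ^ 2 + s * j)
    / (1 - cexp (-(2 * (Real.pi : ℂ) * I * z₂)) * qPow τ j)

def Phi1 (m s τ z₁ z₂ t : ℂ) : ℂ :=
  cexp (-(2 * (Real.pi : ℂ) * I * m * t)) * ∑' j : ℤ, phi1Term m s τ z₁ z₂ j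

def Phi2 (m s τ z₁ z₂ t : ℂ) : ℂ :=
  cexp (-(2 * (Real.pi : ℂ) * I * m * t)) * ∑' j : ℤ, phi2Term m s τ z₁ z₂ j

/-- The mock theta function `Φ^{[m,s]} = Φ₁^{[m,s]} - Φ₂^{[m,s]}`. -/
def Phi (m s τ z₁ z₂ t : ℂ) : ℂ :=
  Phi1 m s τ z₁ z₂ t - Phi2 m s τ z₁ z₂ t

/-- `z` is not in the period lattice `ℤ + ℤ τ`: none of the denominators in the series for `Φ`
vanishes if both variables have this property. -/
def OffLattice (τ z : ℂ) : Prop := ∀ a b : ℤ, z ≠ a + b * τ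

/-! ### The theta functions -/

/-- Jacobi's theta function `θ_{k,m}(τ, z)`. -/
def theta (k m τ z : ℂ) : ℂ :=
  ∑' j : ℤ, cexp (2 * (Real.pi : ℂ) * I * m * (j + k / (2 * m)) * z)
    * qPow τ (m * (j + k / (2 * m)) ^ 2)

/-- The alternating theta function `θ^{(-)}_{k,m}(τ, z)`. -/
def thetaMinus (k m τ z : ℂ) : ℂ :=
  ∑' j : ℤ, (-1 : ℂ) ^ j * cexp (2 * (Real.pi : ℂ) * I * m * (j + k / (2 * m)) * z)
    * qPow τ (m * (j + k / (2 * m)) ^ 2)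

/-- Mumford's theta function `ϑ₁₁(τ, z)`. -/
def vartheta11 (τ z : ℂ) : ℂ :=
  ∑' n : ℤ, cexp ((Real.pi : ℂ) * I * τ * (n + 1 / 2) ^ 2
    + 2 * (Real.pi : ℂ) * I * (n + 1 / 2) * (z + 1 / 2))

/-- The odd combination `[θ_{k,m} - θ_{-k,m}](τ, z)`. -/
def thetaDiff (k m τ z : ℂ) : ℂ := theta k m τ z - theta (-k) m τ z

/-- The sum `e ^ w + e ^ (-w)`. -/
def expSum (w : ℂ) : ℂ := cexp w + cexp (-w)

/-! ### The explicit formula, in terms of `N = 2m`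

No function below refers to `Phi`. -/

/-- The `j`-th term of the double series in the formula for `Φ^{[N/2, 1/2]}(2τ, 2z₁, 2z₂, 0)`; it
is zero for `j = 0`. -/
def halfTerm (N : ℕ) (τ z₁ z₂ : ℂ) (j : ℕ) : ℂ :=
  (∑ r ∈ Finset.Icc 1 j, ∑ k ∈ (Finset.range N).filter Odd,
    (-1 : ℂ) ^ j
      * qPow τ (((N : ℂ) + 1) * (j : ℂ) ^ 2 - (2 * N * ((j : ℂ) - r) + k) ^ 2 / (4 * N))
      * expSum ((Real.pi : ℂ) * I * (2 * N * r - k) * (z₁ - z₂))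
      * thetaDiff k N τ (z₁ + z₂))
  - ∑ r ∈ Finset.range j, ∑ k ∈ (Finset.range N).filter Odd,
    (-1 : ℂ) ^ j
      * qPow τ (((N : ℂ) + 1) * (j : ℂ) ^ 2 - (2 * N * ((j : ℂ) - r) - k) ^ 2 / (4 * N))
      * expSum ((Real.pi : ℂ) * I * (2 * N * r + k) * (z₁ - z₂))
      * thetaDiff k N τ (z₁ + z₂)

/-- The theta function by which the formula for `Φ^{[N/2, 1/2]}(2τ, 2z₁, 2z₂, 0)` is divided. -/
def halfTheta (N : ℕ) (τ z₁ z₂ : ℂ) : ℂ :=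
  thetaMinus 0 (N + 1) τ (N * (z₁ - z₂) / (N + 1))

/-- The explicit expression for `Φ^{[N/2, 1/2]}(2τ, 2z₁, 2z₂, 0)`. -/
def halfFormula (N : ℕ) (τ z₁ z₂ : ℂ) : ℂ :=
  (-I * ModularForm.eta (2 * τ) ^ 3
      * (thetaMinus 0 (N + 1) τ ((z₁ - z₂) / (N + 1) + z₁ + z₂) / vartheta11 (2 * τ) (2 * z₁)
        + thetaMinus 0 (N + 1) τ ((z₁ - z₂) / (N + 1) - z₁ - z₂) / vartheta11 (2 * τ) (2 * z₂))
    + ∑' j : ℕ, halfTerm N τ z₁ z₂ j) / halfTheta N τ z₁ z₂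

/-- The denominators in `halfFormula` do not vanish. -/
def HalfRegular (N : ℕ) (τ z₁ z₂ : ℂ) : Prop :=
  halfTheta N τ z₁ z₂ ≠ 0 ∧ vartheta11 (2 * τ) (2 * z₁) ≠ 0 ∧ vartheta11 (2 * τ) (2 * z₂) ≠ 0

/-- The `j`-th term of the double series in the formula for `Φ^{[N/2, 0]}(2τ, 2z₁, 2z₂, 0)` with
`N` odd; it is zero for `j = 0`. -/
def intTerm (N : ℕ) (τ z₁ z₂ : ℂ) (j : ℕ) : ℂ :=
  -(∑ r ∈ Finset.Icc 1 j, ∑ k ∈ (Finset.range N).filter Even,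
    (-1 : ℂ) ^ j
      * qPow τ (((N : ℂ) + 1) * (j : ℂ) ^ 2 - (2 * N * ((j : ℂ) - r) + N - k) ^ 2 / (4 * N))
      * expSum ((Real.pi : ℂ) * I * (2 * N * r - N + k) * (z₁ - z₂ - τ))
      * thetaDiff k N τ (z₁ + z₂))
  + ∑ r ∈ Finset.range j, ∑ k ∈ (Finset.range N).filter Even,
    (-1 : ℂ) ^ j
      * qPow τ (((N : ℂ) + 1) * (j : ℂ) ^ 2 - (2 * N * ((j : ℂ) - r) - N + k) ^ 2 / (4 * N))
      * expSum ((Real.pi : ℂ) * I * (2 * N * r + N - k) * (z₁ - z₂ - τ))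
      * thetaDiff k N τ (z₁ + z₂)

/-- The theta function by which the formula for `Φ^{[N/2, 0]}(2τ, 2z₁, 2z₂, 0)`, `N` odd, is
divided. -/
def intTheta (N : ℕ) (τ z₁ z₂ : ℂ) : ℂ :=
  thetaMinus (-N) (N + 1) τ (N * (z₁ - z₂) / (N + 1))

/-- The explicit expression for `Φ^{[N/2, 0]}(2τ, 2z₁, 2z₂, 0)` with `N` odd. -/
def intFormula (N : ℕ) (τ z₁ z₂ : ℂ) : ℂ :=
  (-I * ModularForm.eta (2 * τ) ^ 3
      * (thetaMinus N (N + 1) τ ((z₁ - z₂) / (N + 1) + z₁ + z₂) / vartheta11 (2 * τ) (2 * z₁)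
        + thetaMinus N (N + 1) τ ((z₁ - z₂) / (N + 1) - z₁ - z₂) / vartheta11 (2 * τ) (2 * z₂))
    + qPow τ (-(N / (4 * (N + 1)))) * cexp ((Real.pi : ℂ) * I * N / (N + 1) * (z₁ - z₂))
      * ∑' j : ℕ, intTerm N τ z₁ z₂ j) / intTheta N τ z₁ z₂
  + ∑ k ∈ Finset.Icc 1 ((N - 1) / 2),
      cexp (2 * (Real.pi : ℂ) * I * k * (z₁ - z₂)) * qPow τ (-((k : ℂ) ^ 2 / N))
        * thetaDiff k (N / 2) (2 * τ) (2 * z₁ + 2 * z₂)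

/-- The denominators in `intFormula` do not vanish. -/
def IntRegular (N : ℕ) (τ z₁ z₂ : ℂ) : Prop :=
  intTheta N τ z₁ z₂ ≠ 0 ∧ vartheta11 (2 * τ) (2 * z₁) ≠ 0 ∧ vartheta11 (2 * τ) (2 * z₂) ≠ 0

/-- The explicit expression for `Φ^{[N/2, s₀]}(τ, z₁, z₂, 0)`, where `s₀ ∈ {0, 1/2}` is congruent
to `S/2` modulo `1`. If `S` is even, `N = 2 ^ p N₀` with `N₀` odd. -/
def baseFormula (N : ℕ) (S : ℤ) (τ z₁ z₂ : ℂ) : ℂ :=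
  if Even S then
    let p := padicValNat 2 N
    intFormula (N / 2 ^ p) (2 ^ p * τ / 2) (2 ^ p * z₁ / 2) (2 ^ p * z₂ / 2)
      + ∑ i ∈ Finset.range p,
          halfFormula (N / 2 ^ (i + 1)) (2 ^ i * τ) (2 ^ i * z₁) (2 ^ i * z₂)
  else halfFormula N (τ / 2) (z₁ / 2) (z₂ / 2)

/-- The term `e^{π i s (z₁ - z₂)} q^{-s²/(4m)} [θ_{s,m} - θ_{-s,m}](τ, z₁ + z₂)` with
`m = N/2`. -/
def shiftTerm (N : ℕ) (s τ z₁ z₂ : ℂ) : ℂ :=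
  cexp ((Real.pi : ℂ) * I * s * (z₁ - z₂)) * qPow τ (-(s ^ 2 / (2 * N)))
    * thetaDiff s (N / 2) τ (z₁ + z₂)

/-- The explicit expression for `Φ^{[N/2, S/2]}(τ, z₁, z₂, t)`. Here `S/2 = s₀ + n` with
`s₀ ∈ {0, 1/2}` and `n = ⌊S/2⌋`; at most one of the two finite sums is nonempty. -/
def explicitPhi (N : ℕ) (S : ℤ) (τ z₁ z₂ t : ℂ) : ℂ :=
  cexp (-((Real.pi : ℂ) * I * N * t))
    * (baseFormula N S τ z₁ z₂
      - (∑ k ∈ Finset.Ico (0 : ℤ) (S / 2), shiftTerm N (((S % 2 : ℤ) : ℂ) / 2 + k) τ z₁ z₂)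
      + ∑ k ∈ Finset.Ico (S / 2) (0 : ℤ), shiftTerm N (((S % 2 : ℤ) : ℂ) / 2 + k) τ z₁ z₂)

/-- The set of `(z₁, z₂)` for which no denominator in `explicitPhi N S τ z₁ z₂ t` vanishes. -/
def explicitDomain (N : ℕ) (S : ℤ) (τ : ℂ) : Set (ℂ × ℂ) :=
  {z | if Even S then
      let p := padicValNat 2 N
      IntRegular (N / 2 ^ p) (2 ^ p * τ / 2) (2 ^ p * z.1 / 2) (2 ^ p * z.2 / 2)
        ∧ ∀ i ∈ Finset.range p,
            HalfRegular (N / 2 ^ (i + 1)) (2 ^ i * τ) (2 ^ i * z.1) (2 ^ i * z.2)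
    else HalfRegular N (τ / 2) (z.1 / 2) (z.2 / 2)}

end

end MockTheta

namespace MockTheta

/-! ### The normalized exponential -/

/-! Write `N = 2m`, `d = z₁ - z₂`, `u = z₁ + z₂`. The heart is the case `s = 1/2`: after doubling
`τ, z₁, z₂`, the function `Φ` is `thetaAppell N τ z₁ z₂` plus the same sum with `z₁, z₂` exchanged
(`Phi_half_eq`).

Multiply `thetaAppell N τ z₁ z₂` by `θ^{(-)}_{0,N+1}(Nd/(N+1))` and subtract the product of
`θ^{(-)}_{0,N+1}(d/(N+1) + u)` with the simpler sum `appell τ z₁`. Index both double series by `(J,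
l)` so that each term has the denominator belonging to `w = z₁ + (J + l)τ`. With `X = e^{2πiw}` the
numerators then differ by a multiple of `X^{2NJ} - X^{2l}`, so the pole cancels and a finite
geometric sum over `b` between `NJ` and `l` is left (`core_identity`). Thus `thetaAppell` is
expressed by `appell` and an absolutely convergent indefinite theta series (`theta_mul_thetaAppell`,
`summable_coreTerm`).

The sum `appell` is `-iη(2τ)³/ϑ₁₁(2τ, 2z)`. This is the limit of a finite identity in which the
partial fractions of `Y^M / ∏(1 - Yq^j)` are multiplied by the Rothe expansion of the denominator
(`finite_theta_mul_appell`, `theta_mul_appell`). The same identity shows that `ϑ₁₁` vanishes only on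
the lattice.

In the indefinite series an involution of `J` replaces the endpoint `l` by `0` (`tsum_below_id_eq`).
Then `l` runs freely and sums to `θ_{2b+1,N}(τ, u)`, while `b` has finite range for each `J`. Adding
the copy with `z₁, z₂` exchanged turns `θ` into `D`, and joining `J = j` with `J = -j` gives `h_j`
(`hasSum_halfTerm`).

The remaining cases follow from three relations. Raising `s` by one subtracts a finite theta
expression (`Phi_sub_succ`). Translating `z₂` by `τ` leads from `s = 1/2` to `s = (N+1)/2`, an
integer if `N` is odd (`Phi_translate`). Finally `1/(1-x) = (1+x)/(1-x²)` halves an even `N` when `s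
= 0` (`Phi_duplication`).

The domain is dense by Baire's theorem, since only countably many affine lines in `ℂ²` are excluded.
The limit statement holds because `Φ` is continuous off the lattice. -/

/-- The normalized exponential `e ^ (2 π i w)`. -/
noncomputable def ee (w : ℂ) : ℂ := cexp (2 * (Real.pi : ℂ) * I * w)

lemma ee_add (a b : ℂ) : ee (a + b) = ee a * ee b := by
  rw [ee, ee, ee, ← Complex.exp_add]; congr 1; ring

lemma ee_ne_zero (a : ℂ) : ee a ≠ 0 := Complex.exp_ne_zero _

@[simp] lemma ee_zero : ee 0 = 1 := by simp [ee]

lemma ee_neg (a : ℂ) : ee (-a) = (ee a)⁻¹ := by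
  rw [ee, ee, ← Complex.exp_neg]; congr 1; ring

lemma ee_int_mul (n : ℤ) (a : ℂ) : ee (n * a) = ee a ^ n := by
  rw [ee, ee, ← Complex.exp_int_mul]; congr 1; ring

lemma ee_nat_mul (n : ℕ) (a : ℂ) : ee (n * a) = ee a ^ n := by
  rw [ee, ee, ← Complex.exp_nat_mul]; congr 1; ring

lemma ee_int (n : ℤ) : ee n = 1 := by
  rw [ee, show 2 * (Real.pi : ℂ) * I * n = n * (2 * Real.pi * I) by ring]
  exact Complex.exp_int_mul_two_pi_mul_I n

lemma ee_half : ee (1 / 2) = -1 := by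
  rw [ee, show 2 * (Real.pi : ℂ) * I * (1 / 2) = Real.pi * I by ring, Complex.exp_pi_mul_I]

lemma ee_half_int (n : ℤ) : ee (n / 2) = (-1) ^ n := by
  rw [show (n : ℂ) / 2 = n * (1 / 2) by ring, ee_int_mul, ee_half]

lemma ee_eq_one_iff (a : ℂ) : ee a = 1 ↔ ∃ n : ℤ, a = n := by
  rw [ee, Complex.exp_eq_one_iff]
  have : (2 * (Real.pi : ℂ) * I) ≠ 0 := Complex.two_pi_I_ne_zero
  refine exists_congr fun n => ⟨fun h => ?_, fun h => ?_⟩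
  · apply mul_left_cancel₀ this; rw [h]; ring
  · rw [h]; ring

lemma norm_ee (a : ℂ) : ‖ee a‖ = Real.exp (-(2 * Real.pi * a.im)) := by
  rw [ee, Complex.norm_exp]; congr 1; simp

lemma qPow_eq (τ a : ℂ) : qPow τ a = ee (τ * a) := by
  rw [qPow, ee]; congr 1; ring

@[fun_prop] lemma continuous_ee : Continuous ee := by
  unfold ee; fun_prop

lemma norm_neg_one_zpow (n : ℤ) : ‖(-1 : ℂ) ^ n‖ = 1 := by simp

/-! ### Gaussian summability -/

lemma summable_gauss {a : ℝ} (ha : 0 < a) (b : ℝ) :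
    Summable fun n : ℤ => Real.exp (-(a * (n : ℝ) ^ 2) + b * |(n : ℝ)|) := by
  -- The library bound is `exp(-π(T n² - 2 S |n|))`; hence `S = b/(2π)` and `T = a/π`.
  have h := summable_pow_mul_jacobiTheta₂_term_bound (b / (2 * Real.pi))
    (T := a / Real.pi) (by positivity) 0
  refine h.congr fun n => ?_
  simp only [pow_zero, one_mul, Int.cast_abs]
  congr 1
  field_simp
  ring

lemma summable_of_norm_le_gauss {f : ℤ → ℂ} {a b c : ℝ} (ha : 0 < a)
    (h : ∀ n, ‖f n‖ ≤ c * Real.exp (-(a * (n : ℝ) ^ 2) + b * |(n : ℝ)|)) : Summable f :=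
  Summable.of_norm_bounded ((summable_gauss ha b).mul_left c) h

lemma summable_gauss_three {a : ℝ} (ha : 0 < a) (b : ℝ) :
    Summable fun p : ℤ × ℤ × ℤ => Real.exp (-(a * ((p.1 : ℝ) ^ 2 + (p.2.1 : ℝ) ^ 2 + (p.2.2 : ℝ) ^ 2))
      + b * (|(p.1 : ℝ)| + |(p.2.1 : ℝ)| + |(p.2.2 : ℝ)|)) := by
  have h := summable_gauss ha b
  have h2 := h.mul_of_nonneg h (fun _ => (Real.exp_pos _).le) (fun _ => (Real.exp_pos _).le)
  have h3 := h.mul_of_nonneg h2 (fun _ => (Real.exp_pos _).le)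
    (fun _ => mul_nonneg (Real.exp_pos _).le (Real.exp_pos _).le)
  refine h3.congr fun p => ?_
  rw [← Real.exp_add, ← Real.exp_add]
  congr 1; ring

/-- Norm of the exponential of a real combination of `τ` and two variables. -/
lemma norm_ee_comb_le (τ z w : ℂ) (Q a b R : ℝ) (hR : |a| ≤ R) (hR' : |b| ≤ R) :
    ‖ee (τ * Q + a * z + b * w)‖
      ≤ Real.exp (-(2 * Real.pi * τ.im * Q) + 2 * Real.pi * (|z.im| + |w.im|) * R) := by
  rw [norm_ee]
  apply Real.exp_le_exp.mpr
  have h1 : (τ * Q + a * z + b * w).im = τ.im * Q + a * z.im + b * w.im := by simp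
  rw [h1]
  have hp := Real.pi_pos
  have h2 : -(a * z.im) ≤ R * |z.im| := by
    calc -(a * z.im) ≤ |a * z.im| := neg_le_abs _
      _ = |a| * |z.im| := abs_mul _ _
      _ ≤ _ := by gcongr
  have h3 : -(b * w.im) ≤ R * |w.im| := by
    calc -(b * w.im) ≤ |b * w.im| := neg_le_abs _
      _ = |b| * |w.im| := abs_mul _ _
      _ ≤ _ := by gcongr
  nlinarith [mul_le_mul_of_nonneg_left (add_le_add h2 h3) (by positivity : 0 ≤ 2 * Real.pi)]

lemma summable_ee_quadratic {τ : ℂ} (hτ : 0 < τ.im) {a : ℝ} (ha : 0 < a) (z w : ℂ) :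
    Summable fun n : ℤ => ee (τ * (a * (n : ℂ) ^ 2) + n * z + w) := by
  refine summable_of_norm_le_gauss (a := 2 * Real.pi * τ.im * a)
    (b := 2 * Real.pi * |z.im|) (c := ‖ee w‖) (by positivity) fun n => ?_
  rw [ee_add, norm_mul, mul_comm]
  gcongr
  have := norm_ee_comb_le τ z 0 (a * (n : ℝ) ^ 2) n 0 |(n : ℝ)| le_rfl (by simp)
  push_cast at this
  simp only [mul_zero, add_zero, Complex.zero_im, abs_zero] at this
  refine this.trans (le_of_eq ?_)
  congr 1; ring

lemma summable_neg_one_zpow_mul {f : ℤ → ℂ} (h : Summable f) :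
    Summable fun n : ℤ => (-1 : ℂ) ^ n * f n :=
  Summable.of_norm (by simpa using h.norm)

/-! ### Finite `q`-series -/

/-- The finite product `(1 - q) (1 - q ^ 2) ⋯ (1 - q ^ k)`. -/
noncomputable def qFact (q : ℂ) (k : ℕ) : ℂ := ∏ i ∈ Finset.range k, (1 - q ^ (i + 1))

lemma qFact_zero (q : ℂ) : qFact q 0 = 1 := by simp [qFact]

lemma qFact_succ (q : ℂ) (k : ℕ) : qFact q (k + 1) = qFact q k * (1 - q ^ (k + 1)) := by
  simp [qFact, Finset.prod_range_succ]

lemma one_sub_pow_ne_zero {q : ℂ} (hq : ‖q‖ < 1) (i : ℕ) : 1 - q ^ (i + 1) ≠ 0 := by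
  intro h
  have h1 : ‖q ^ (i + 1)‖ = 1 := by rw [← sub_eq_zero.mp h]; simp
  rw [norm_pow] at h1
  exact absurd h1 (pow_lt_one₀ (norm_nonneg _) hq (by omega)).ne

lemma qFact_ne_zero {q : ℂ} (hq : ‖q‖ < 1) (k : ℕ) : qFact q k ≠ 0 :=
  Finset.prod_ne_zero_iff.mpr fun i _ => one_sub_pow_ne_zero hq i

/-- The coefficients of `∏ k < K, (1 - Y q ^ k)` as a polynomial in `Y`. -/
noncomputable def rotheCoeff (q : ℂ) (K n : ℕ) : ℂ :=
  if n ≤ K then (-1) ^ n * q ^ (n.choose 2) * (qFact q K / (qFact q n * qFact q (K - n))) else 0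

lemma rotheCoeff_zero {q : ℂ} (hq : ‖q‖ < 1) (K : ℕ) : rotheCoeff q K 0 = 1 := by
  have := qFact_ne_zero hq K
  simp [rotheCoeff, qFact_zero, this]

/-- The `q`-Pascal rule, which compares coefficients when the factor `1 - Y q^K` is added. The
boundary case `n = K` is separate because there `rotheCoeff q K (K + 1)` is the default value `0`.
-/
lemma rotheCoeff_succ_succ {q : ℂ} (hq : ‖q‖ < 1) {K n : ℕ} (hn : n ≤ K) :
    rotheCoeff q (K + 1) (n + 1) = rotheCoeff q K (n + 1) - q ^ K * rotheCoeff q K n := by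
  have hc : (n + 1).choose 2 = n + n.choose 2 := by
    rw [Nat.choose_succ_succ' n 1, Nat.choose_one_right]
  rcases hn.eq_or_lt with rfl | hlt
  · have h0 := qFact_ne_zero hq n
    have h1 := qFact_ne_zero hq (n + 1)
    simp only [rotheCoeff, le_refl, if_true, Nat.sub_self, qFact_zero, hc,
      show ¬ (n + 1 ≤ n) by omega, if_false]
    field_simp
    ring
  · obtain ⟨d, rfl⟩ := Nat.exists_eq_add_of_lt hlt
    have h0 := qFact_ne_zero hq n
    have h1 := qFact_ne_zero hq d
    have h2 := one_sub_pow_ne_zero hq n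
    have h3 := one_sub_pow_ne_zero hq d
    simp only [rotheCoeff, show n + 1 ≤ n + d + 1 + 1 by omega, show n + 1 ≤ n + d + 1 by omega,
      show n ≤ n + d + 1 by omega, if_true, show n + d + 1 + 1 - (n + 1) = d + 1 by omega,
      show n + d + 1 - (n + 1) = d by omega, show n + d + 1 - n = d + 1 by omega, hc,
      qFact_succ q (n + d + 1), qFact_succ q n, qFact_succ q d]
    field_simp
    ring

/-- Rothe's `q`-binomial theorem. -/
lemma prod_one_sub_mul_pow {q : ℂ} (hq : ‖q‖ < 1) (Y : ℂ) (K : ℕ) :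
    ∏ k ∈ Finset.range K, (1 - Y * q ^ k)
      = ∑ n ∈ Finset.range (K + 1), rotheCoeff q K n * Y ^ n := by
  induction K with
  | zero => simp [rotheCoeff, qFact_zero]
  | succ K ih =>
    have h0 : ∑ n ∈ Finset.range (K + 1), rotheCoeff q (K + 1) (n + 1) * Y ^ (n + 1)
        = ∑ n ∈ Finset.range (K + 1),
          (rotheCoeff q K (n + 1) - q ^ K * rotheCoeff q K n) * Y ^ (n + 1) :=
      Finset.sum_congr rfl fun n hn => by
        rw [rotheCoeff_succ_succ hq (Nat.lt_succ_iff.mp (Finset.mem_range.mp hn))]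
    rw [Finset.prod_range_succ, ih, Finset.sum_range_succ' _ (K + 1), rotheCoeff_zero hq, h0]
    have h1 : ∑ n ∈ Finset.range (K + 1), rotheCoeff q K (n + 1) * Y ^ (n + 1)
        = ∑ n ∈ Finset.range (K + 1), rotheCoeff q K n * Y ^ n - 1 := by
      rw [Finset.sum_range_succ, Finset.sum_range_succ' _ K, rotheCoeff_zero hq]
      simp [rotheCoeff]
    simp only [sub_mul, Finset.sum_sub_distrib, h1]
    have h2 : ∀ n, q ^ K * rotheCoeff q K n * Y ^ (n + 1)
        = rotheCoeff q K n * Y ^ n * (Y * q ^ K) := fun n => by ring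
    simp only [h2]
    rw [← Finset.sum_mul]
    ring

lemma prod_range_neg_zpow {q : ℂ} (hq : q ≠ 0) (k : ℕ) :
    (∏ j ∈ Finset.range k, (-q ^ (-(j : ℤ)))) * q ^ (k ^ 2)
      = (-1) ^ k * q ^ ((k + 1).choose 2) := by
  induction k with
  | zero => simp
  | succ k ih =>
    have hc : (k + 1 + 1).choose 2 = (k + 1) + (k + 1).choose 2 := by
      rw [Nat.choose_succ_succ' (k + 1) 1, Nat.choose_one_right]
    rw [Finset.prod_range_succ, hc, pow_succ (-1 : ℂ), pow_add q (k + 1),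
      show (k + 1) ^ 2 = k ^ 2 + (2 * k + 1) by ring, pow_add q (k ^ 2)]
    have h : q ^ (-(k : ℤ)) * q ^ (2 * k + 1) = q ^ (k + 1) := by
      rw [zpow_neg, zpow_natCast, show 2 * k + 1 = k + (k + 1) by ring, pow_add q k (k + 1)]
      field_simp
    linear_combination (-q ^ (-(k : ℤ)) * q ^ (2 * k + 1)) * ih
      - (-1) ^ k * q ^ ((k + 1).choose 2) * h

/-- The partial fraction expansion of `Y ^ p / ∏ j ≤ K, (1 - Y q ^ j)`. -/
lemma pow_eq_prod_mul_sum {q : ℂ} (hq0 : q ≠ 0) (hq : ‖q‖ < 1) (Y : ℂ) {p K : ℕ} (hp : p ≤ K)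
    (hY : ∀ j : ℕ, 1 - Y * q ^ j ≠ 0) :
    Y ^ p = (∏ j ∈ Finset.range (K + 1), (1 - Y * q ^ j)) *
      ∑ k ∈ Finset.range (K + 1), (-1) ^ k * q ^ ((k + 1).choose 2) * (q ^ (-(k : ℤ))) ^ p
        / (qFact q k * qFact q (K - k)) / (1 - Y * q ^ k) := by
  classical
  set v : ℕ → ℂ := fun j => q ^ (-(j : ℤ)) with hv
  have hvj : ∀ j, v j * q ^ j = 1 := fun j => by
    simp only [hv, zpow_neg, zpow_natCast]; exact inv_mul_cancel₀ (pow_ne_zero _ hq0)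
  have hv0 : ∀ j, v j ≠ 0 := fun j => zpow_ne_zero _ hq0
  have hYv : ∀ j, Y - v j = -v j * (1 - Y * q ^ j) := fun j => by
    linear_combination (-Y) * hvj j
  have hYne : ∀ j, Y ≠ v j := fun j h => by
    apply hY j; rw [h, hvj, sub_self]
  have hinj : Set.InjOn v (Finset.range (K + 1)) := by
    intro i _ j _ hij
    simp only [hv] at hij
    by_contra hne
    have key : ∀ a b : ℕ, a < b → q ^ (-(a : ℤ)) ≠ q ^ (-(b : ℤ)) := by
      intro a b hab h
      obtain ⟨d, rfl⟩ := Nat.exists_eq_add_of_lt hab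
      apply one_sub_pow_ne_zero hq d
      have h1 := hvj a
      have h2 := hvj (a + d + 1)
      simp only [hv] at h1 h2
      rw [← h, show a + d + 1 = a + (d + 1) by ring, pow_add, ← mul_assoc, h1, one_mul] at h2
      rw [h2, sub_self]
    rcases lt_or_gt_of_ne hne with h | h
    · exact key i j h hij
    · exact key j i h hij.symm
  -- Since `p ≤ K`, the monomial `X^p` equals its interpolation polynomial at the `K + 1` nodes
  -- `q^{-j}`. Dividing by the nodal polynomial, which is the product up to a constant, gives the
  -- partial fractions.
  have hinterp := Lagrange.eq_interpolate (s := Finset.range (K + 1)) (v := v)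
    (f := (Polynomial.X : Polynomial ℂ) ^ p) hinj (by
      rw [Polynomial.degree_X_pow, Finset.card_range]; exact_mod_cast Nat.lt_succ_of_le hp)
  have hE := congrArg (Polynomial.eval Y) hinterp
  rw [Lagrange.eval_interpolate_not_at_node _ (fun i _ => hYne i), Lagrange.eval_nodal] at hE
  simp only [Polynomial.eval_pow, Polynomial.eval_X] at hE
  rw [hE]
  have hprod : ∏ j ∈ Finset.range (K + 1), (Y - v j)
      = (∏ j ∈ Finset.range (K + 1), (-v j)) * ∏ j ∈ Finset.range (K + 1), (1 - Y * q ^ j) := by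
    rw [← Finset.prod_mul_distrib]
    exact Finset.prod_congr rfl fun j _ => hYv j
  rw [hprod, mul_comm (∏ j ∈ Finset.range (K + 1), (-v j)), mul_assoc, Finset.mul_sum]
  congr 1
  refine Finset.sum_congr rfl fun k hk => ?_
  have hkK : k ≤ K := Nat.lt_succ_iff.mp (Finset.mem_range.mp hk)
  obtain ⟨d, rfl⟩ := Nat.exists_eq_add_of_le hkK
  -- The nodes below and above `k` contribute separately: `v k - v j` is `v k (1 - q^{k-j})` for `j
  -- < k` and `-v j (1 - q^{j-k})` for `j > k`.
  have hw : (Lagrange.nodalWeight (Finset.range (k + d + 1)) v k)⁻¹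
      = (v k ^ k * qFact q k) * ((∏ j ∈ Finset.range d, (-v (k + 1 + j))) * qFact q d) := by
    rw [Lagrange.nodalWeight, Finset.prod_inv_distrib, inv_inv]
    have hs : (Finset.range (k + d + 1)).erase k
        = Finset.range k ∪ (Finset.range d).image (fun j => k + 1 + j) := by
      ext x
      simp only [Finset.mem_erase, Finset.mem_range, Finset.mem_union, Finset.mem_image]
      constructor
      · rintro ⟨h1, h2⟩
        rcases lt_or_gt_of_ne h1 with h | h
        · exact Or.inl h
        · exact Or.inr ⟨x - (k + 1), by omega, by omega⟩
      · rintro (h | ⟨a, h1, h2⟩) <;> omega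
    rw [hs, Finset.prod_union, Finset.prod_image (by intro a _ b _ h; simpa using h)]
    · congr 1
      · have : ∀ j ∈ Finset.range k, v k - v j = v k * (1 - q ^ (k - j)) := by
          intro j hj
          have hj' := Finset.mem_range.mp hj
          obtain ⟨e, rfl⟩ := Nat.exists_eq_add_of_lt hj'
          have h1 := hvj (j + e + 1)
          have h2 := hvj j
          have h3 : j + e + 1 - j = e + 1 := by omega
          rw [h3]
          have : v (j + e + 1) * q ^ (e + 1) = v j := by
            have h4 : v (j + e + 1) * q ^ (e + 1) * q ^ j = v j * q ^ j := by
              rw [h2, ← h1, mul_assoc, ← pow_add]; congr 2; ring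
            exact mul_right_cancel₀ (pow_ne_zero _ hq0) h4
          linear_combination this
        rw [Finset.prod_congr rfl this, Finset.prod_mul_distrib, Finset.prod_const,
          Finset.card_range, qFact, ← Finset.prod_range_reflect (fun i => 1 - q ^ (i + 1))]
        congr 1
        refine Finset.prod_congr rfl fun j hj => ?_
        have hj' := Finset.mem_range.mp hj
        rw [show k - 1 - j + 1 = k - j by omega]
      · rw [qFact, ← Finset.prod_mul_distrib]
        refine Finset.prod_congr rfl fun j _ => ?_
        have : v (k + 1 + j) * q ^ (j + 1) = v k := by
          have h4 : v (k + 1 + j) * q ^ (j + 1) * q ^ k = v k * q ^ k := by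
            rw [hvj k, ← hvj (k + 1 + j), mul_assoc, ← pow_add]; congr 2; ring
          exact mul_right_cancel₀ (pow_ne_zero _ hq0) h4
        linear_combination (-1 : ℂ) * this
    · rw [Finset.disjoint_left]
      intro x hx hx'
      simp only [Finset.mem_range, Finset.mem_image] at hx hx'
      obtain ⟨a, _, h⟩ := hx'
      omega
  have hsplit : ∏ j ∈ Finset.range (k + d + 1), (-v j)
      = (∏ j ∈ Finset.range k, (-v j)) * (-v k) * ∏ j ∈ Finset.range d, (-v (k + 1 + j)) := by
    rw [show k + d + 1 = k + 1 + d by ring, Finset.prod_range_add, Finset.prod_range_succ]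
  have hpz := prod_range_neg_zpow hq0 k
  have hvk : v k ^ k * q ^ (k ^ 2) = 1 := by
    rw [sq, pow_mul, ← mul_pow, hvj, one_pow]
  have hw' := congrArg (·⁻¹) hw
  simp only [inv_inv] at hw'
  have hD : ∏ j ∈ Finset.range d, (-v (k + 1 + j)) ≠ 0 :=
    Finset.prod_ne_zero_iff.mpr fun j _ => neg_ne_zero.mpr (hv0 _)
  have hqk := qFact_ne_zero hq k
  have hqd := qFact_ne_zero hq d
  rw [hw', hsplit, hYv k, show k + d - k = d by omega, ← hpz]
  have h1 := hY k
  have h2 := hv0 k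
  have hqk2 : q ^ k ^ 2 = (v k ^ k)⁻¹ := eq_inv_of_mul_eq_one_right hvk
  rw [hqk2]
  change _ = (∏ j ∈ Finset.range k, -v j) * (v k ^ k)⁻¹ * v k ^ p / (qFact q k * qFact q d)
    / (1 - Y * q ^ k)
  field_simp

/-! ### The denominators of Appell sums -/

lemma ee_add_int_mul_ne_one {τ z : ℂ} (h : OffLattice τ z) (n : ℤ) : 1 - ee (z + n * τ) ≠ 0 := by
  intro h0
  obtain ⟨a, ha⟩ := (ee_eq_one_iff _).mp (sub_eq_zero.mp h0).symm
  apply h a (-n)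
  push_cast
  linear_combination ha

lemma norm_inv_one_sub_le_two {w : ℂ} (h : ‖w‖ ≤ 1 / 2 ∨ 2 ≤ ‖w‖) : ‖(1 - w)⁻¹‖ ≤ 2 := by
  have h1 : (1 : ℝ) / 2 ≤ ‖1 - w‖ := by
    rcases h with h | h
    · have := norm_sub_norm_le (1 : ℂ) w
      rw [norm_one] at this; linarith
    · have := norm_sub_norm_le w (1 : ℂ)
      rw [norm_one, norm_sub_rev] at this; linarith
  rw [norm_inv]
  calc ‖1 - w‖⁻¹ ≤ (1 / 2)⁻¹ := inv_anti₀ (by norm_num) h1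
    _ = 2 := by norm_num

/-- For large `|n|` the exponential has norm at most `1/2` or at least `2`, uniformly for `z` near
`z₀`; the finitely many other `n` are handled by continuity. Uniformity in `n` and `z` serves both
summability and continuity. -/
lemma exists_eventually_norm_inv_one_sub_ee_le {τ z₀ : ℂ} (hτ : 0 < τ.im) (h : OffLattice τ z₀) :
    ∃ C : ℝ, 0 ≤ C ∧ ∀ᶠ z in 𝓝 z₀, ∀ n : ℤ, ‖(1 - ee (z + n * τ))⁻¹‖ ≤ C := by
  obtain ⟨n₀, hn₀⟩ := exists_nat_gt ((|z₀.im| + 2) / τ.im)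
  rw [div_lt_iff₀ hτ] at hn₀
  have hpi := Real.pi_gt_three
  have hfin : ∀ n ∈ Finset.Icc (-(n₀ : ℤ)) n₀, ∀ᶠ z in 𝓝 z₀,
      ‖(1 - ee (z + n * τ))⁻¹‖ < ‖(1 - ee (z₀ + n * τ))⁻¹‖ + 1 := by
    intro n _
    have hc' : ContinuousAt (fun z => 1 - ee (z + n * τ)) z₀ := by fun_prop
    have hc : ContinuousAt (fun z => ‖(1 - ee (z + n * τ))⁻¹‖) z₀ :=
      (hc'.inv₀ (ee_add_int_mul_ne_one h n)).norm
    exact hc.eventually (gt_mem_nhds (lt_add_one _))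
  have him : ∀ᶠ z in 𝓝 z₀, |z.im - z₀.im| < 1 := by
    have hc : ContinuousAt (fun z : ℂ => |z.im - z₀.im|) z₀ := by fun_prop
    exact hc.eventually (gt_mem_nhds (by simp))
  refine ⟨2 + ∑ n ∈ Finset.Icc (-(n₀ : ℤ)) n₀, (‖(1 - ee (z₀ + n * τ))⁻¹‖ + 1), by positivity, ?_⟩
  filter_upwards [(Finset.eventually_all _).mpr hfin, him] with z hz hzi n
  have hsum : 0 ≤ ∑ n ∈ Finset.Icc (-(n₀ : ℤ)) n₀, (‖(1 - ee (z₀ + n * τ))⁻¹‖ + 1) := by positivity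
  have hz1 : |z.im| ≤ |z₀.im| + 1 := by
    have := abs_add_le (z.im - z₀.im) z₀.im
    rw [sub_add_cancel] at this; linarith
  have hz2 := abs_le.mp hz1
  by_cases hn : n ∈ Finset.Icc (-(n₀ : ℤ)) n₀
  · have h1 := hz n hn
    have h2 := Finset.single_le_sum (f := fun n : ℤ => ‖(1 - ee (z₀ + n * τ))⁻¹‖ + 1)
      (fun i _ => by positivity) hn
    linarith
  · refine (norm_inv_one_sub_le_two ?_).trans (by linarith)
    rw [norm_ee]
    have hi : (z + n * τ).im = z.im + n * τ.im := by simp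
    rw [hi]
    rw [Finset.mem_Icc, not_and_or, not_le, not_le] at hn
    have he : (2 : ℝ) ≤ Real.exp 1 := by have := Real.exp_one_gt_d9; linarith
    rcases hn with hn | hn
    · right
      have hn' : (n : ℝ) ≤ -(n₀ : ℝ) := by exact_mod_cast hn.le
      refine he.trans (Real.exp_le_exp.mpr ?_)
      have : z.im + n * τ.im ≤ -1 := by nlinarith
      nlinarith
    · left
      have hn' : (n₀ : ℝ) ≤ (n : ℝ) := by exact_mod_cast hn.le
      have h1 : 1 ≤ z.im + n * τ.im := by nlinarith
      calc Real.exp (-(2 * Real.pi * (z.im + n * τ.im))) ≤ Real.exp (-1) :=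
            Real.exp_le_exp.mpr (by nlinarith)
        _ = (Real.exp 1)⁻¹ := Real.exp_neg 1
        _ ≤ 2⁻¹ := inv_anti₀ (by norm_num) he
        _ = 1 / 2 := by norm_num

lemma exists_norm_inv_one_sub_ee_le {τ z : ℂ} (hτ : 0 < τ.im) (h : OffLattice τ z) :
    ∃ C : ℝ, 0 ≤ C ∧ ∀ n : ℤ, ‖(1 - ee (z + n * τ))⁻¹‖ ≤ C := by
  obtain ⟨C, hC, hz⟩ := exists_eventually_norm_inv_one_sub_ee_le hτ h
  exact ⟨C, hC, hz.self_of_nhds⟩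

/-! ### The reciprocal of `ϑ₁₁` as an Appell sum -/

/-- The integer `n (n + 1) / 2`. -/
def tri (n : ℤ) : ℤ := n * (n + 1) / 2

lemma two_mul_tri (n : ℤ) : 2 * tri n = n * (n + 1) :=
  Int.mul_ediv_cancel' (Int.even_mul_succ_self n).two_dvd

lemma cast_tri (n : ℤ) : (tri n : ℂ) = n * (n + 1) / 2 := by
  have := congrArg (Int.cast : ℤ → ℂ) (two_mul_tri n)
  push_cast at this
  linear_combination this / 2

lemma two_mul_cast_choose_two (n : ℕ) : 2 * ((n.choose 2 : ℕ) : ℤ) = n * (n - 1) := by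
  induction n with
  | zero => simp
  | succ n ih =>
    rw [Nat.choose_succ_succ' n 1, Nat.choose_one_right]
    push_cast
    linear_combination ih

lemma sum_range_add_int {M : Type*} [AddCommMonoid M] (g : ℤ → M) (c : ℤ) (K : ℕ) :
    ∑ k ∈ Finset.range K, g (k + c) = ∑ n ∈ Finset.Ico c (c + K), g n := by
  refine Finset.sum_bij (fun k _ => (k : ℤ) + c) ?_ ?_ ?_ ?_
  · intro k hk; simp only [Finset.mem_range, Finset.mem_Ico] at *; omega
  · intro a _ b _ h; simpa using h
  · intro n hn
    rw [Finset.mem_Ico] at hn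
    exact ⟨(n - c).toNat, by simp; omega, by omega⟩
  · intro k _; rfl

/-- A finite form of `theta_mul_appell`: the first sum is the Rothe expansion of `∏ (1 - X q^n)`
over `-M ≤ n ≤ M`, the second the partial fraction expansion of a monomial divided by this product.
They cancel up to the factor `-X⁻¹`. -/
lemma finite_theta_mul_appell {q X : ℂ} (hq0 : q ≠ 0) (hq : ‖q‖ < 1) (hX0 : X ≠ 0)
    (hX : ∀ n : ℤ, 1 - X * q ^ n ≠ 0) (M : ℕ) :
    X * (∑ i ∈ Finset.Ico (-((M : ℤ) + 1)) (M + 1), (-1) ^ i * q ^ tri i * X ^ i *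
        (qFact q (2 * M + 1) / (qFact q (M + 1 + i).toNat * qFact q (M - i).toNat))) *
      (∑ n ∈ Finset.Ico (-(M : ℤ)) (M + 1), (-1) ^ n * q ^ tri n / (1 - X * q ^ n) /
        (qFact q (M + n).toNat * qFact q (M - n).toNat)) = -1 := by
  -- The shift by `q^{-M}` centres the product, and `p = M` makes the exponents in the partial
  -- fractions the triangular numbers `tri n`, up to a constant.
  set Y : ℂ := X * q ^ (-(M : ℤ)) with hYdef
  have hYj : ∀ j : ℕ, Y * q ^ j = X * q ^ ((j : ℤ) + -M) := fun j => by
    rw [hYdef, mul_assoc, ← zpow_natCast q j, ← zpow_add₀ hq0, add_comm]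
  have hY : ∀ j : ℕ, 1 - Y * q ^ j ≠ 0 := fun j => by rw [hYj]; exact hX _
  have hpf := pow_eq_prod_mul_sum hq0 hq Y (p := M) (K := 2 * M) (by omega) hY
  rw [prod_one_sub_mul_pow hq] at hpf
  have hA : ∑ n ∈ Finset.range (2 * M + 1 + 1), rotheCoeff q (2 * M + 1) n * Y ^ n
      = (-1) ^ (M + 1) * q ^ (-tri M) * X ^ (M + 1) *
      ∑ i ∈ Finset.Ico (-((M : ℤ) + 1)) (M + 1), (-1) ^ i * q ^ tri i * X ^ i *
        (qFact q (2 * M + 1) / (qFact q (M + 1 + i).toNat * qFact q (M - i).toNat)) := by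
    have h := sum_range_add_int (fun i : ℤ => (-1) ^ i * q ^ tri i * X ^ i *
        (qFact q (2 * M + 1) / (qFact q (M + 1 + i).toNat * qFact q (M - i).toNat)))
        (-((M : ℤ) + 1)) (2 * M + 1 + 1)
    rw [show -((M : ℤ) + 1) + ((2 * M + 1 + 1 : ℕ) : ℤ) = M + 1 by push_cast; ring] at h
    rw [← h, Finset.mul_sum]
    refine Finset.sum_congr rfl fun n hn => ?_
    have hn' : n ≤ 2 * M + 1 := Nat.lt_succ_iff.mp (Finset.mem_range.mp hn)
    rw [rotheCoeff, if_pos hn', show ((M : ℤ) + 1 + (n + -(M + 1))).toNat = n by omega,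
      show ((M : ℤ) - (n + -(M + 1))).toNat = 2 * M + 1 - n by omega]
    have e1 : (-1 : ℂ) ^ (M + 1) * (-1) ^ ((n : ℤ) + -(M + 1)) = (-1) ^ n := by
      rw [← zpow_natCast, ← zpow_natCast, ← zpow_add₀ (by norm_num)]
      congr 1; push_cast; ring
    have e2 : X ^ (M + 1) * X ^ ((n : ℤ) + -(M + 1)) = X ^ n := by
      rw [← zpow_natCast, ← zpow_natCast, ← zpow_add₀ hX0]
      congr 1; push_cast; ring
    have e3 : q ^ n.choose 2 * (q ^ (-(M : ℤ))) ^ n = q ^ (-tri M) * q ^ tri (n + -(M + 1)) := by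
      rw [← zpow_natCast, ← zpow_natCast, ← zpow_mul, ← zpow_add₀ hq0, ← zpow_add₀ hq0]
      congr 1
      have h1 := two_mul_tri M
      have h2 := two_mul_tri (n + -(M + 1))
      have h3 := two_mul_cast_choose_two n
      linarith
    rw [hYdef, mul_pow, ← e1, ← e2]
    linear_combination ((-1 : ℂ) ^ (M + 1) * (-1) ^ ((n : ℤ) + -(M + 1))
      * (X ^ (M + 1) * X ^ ((n : ℤ) + -(M + 1))) *
      (qFact q (2 * M + 1) / (qFact q n * qFact q (2 * M + 1 - n)))) * e3
  have hB : ∑ k ∈ Finset.range (2 * M + 1), (-1) ^ k * q ^ ((k + 1).choose 2) * (q ^ (-(k : ℤ))) ^ M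
        / (qFact q k * qFact q (2 * M - k)) / (1 - Y * q ^ k)
      = (-1) ^ M * q ^ (tri M) * q ^ (-(M : ℤ) * M) *
      ∑ n ∈ Finset.Ico (-(M : ℤ)) (M + 1), (-1) ^ n * q ^ tri n / (1 - X * q ^ n) /
        (qFact q (M + n).toNat * qFact q (M - n).toNat) := by
    have h := sum_range_add_int (fun n : ℤ => (-1) ^ n * q ^ tri n / (1 - X * q ^ n) /
        (qFact q (M + n).toNat * qFact q (M - n).toNat)) (-(M : ℤ)) (2 * M + 1)
    rw [show -(M : ℤ) + ((2 * M + 1 : ℕ) : ℤ) = M + 1 by push_cast; ring] at h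
    rw [← h, Finset.mul_sum]
    refine Finset.sum_congr rfl fun n hn => ?_
    have hn' : n ≤ 2 * M := Nat.lt_succ_iff.mp (Finset.mem_range.mp hn)
    rw [show ((M : ℤ) + (n + -M)).toNat = n by omega,
      show ((M : ℤ) - (n + -M)).toNat = 2 * M - n by omega, hYj]
    have e1 : (-1 : ℂ) ^ M * (-1) ^ ((n : ℤ) + -M) = (-1) ^ n := by
      rw [← zpow_natCast, ← zpow_natCast, ← zpow_add₀ (by norm_num)]
      congr 1; ring
    have e3 : q ^ (n + 1).choose 2 * (q ^ (-(n : ℤ))) ^ M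
        = q ^ (tri M) * q ^ (-(M : ℤ) * M) * q ^ tri (n + -M) := by
      rw [← zpow_natCast, ← zpow_natCast, ← zpow_mul, ← zpow_add₀ hq0, ← zpow_add₀ hq0,
        ← zpow_add₀ hq0]
      congr 1
      have h1 := two_mul_tri M
      have h2 := two_mul_tri (n + -M)
      have h3 := two_mul_cast_choose_two (n + 1)
      push_cast at h3
      linarith
    rw [← e1, mul_assoc ((-1) ^ M * (-1) ^ ((n : ℤ) + -M)), e3]
    ring
  rw [hA, hB, hYdef, mul_pow] at hpf
  set S := ∑ i ∈ Finset.Ico (-((M : ℤ) + 1)) (M + 1), (-1) ^ i * q ^ tri i * X ^ i *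
        (qFact q (2 * M + 1) / (qFact q (M + 1 + i).toNat * qFact q (M - i).toNat))
  set T := ∑ n ∈ Finset.Ico (-(M : ℤ)) (M + 1), (-1) ^ n * q ^ tri n / (1 - X * q ^ n) /
        (qFact q (M + n).toNat * qFact q (M - n).toNat)
  have e4 : (q ^ (-(M : ℤ))) ^ M = q ^ (-(M : ℤ) * M) := by
    rw [← zpow_natCast, ← zpow_mul]
  have e5 : q ^ (-tri M) * q ^ tri M = 1 := by
    rw [← zpow_add₀ hq0]; simp
  have e6 : (-1 : ℂ) ^ (M + 1) * (-1) ^ M = -1 := by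
    rw [← pow_add, show M + 1 + M = 2 * M + 1 by ring, pow_succ, pow_mul]; norm_num
  rw [e4] at hpf
  have hne : X ^ M * q ^ (-(M : ℤ) * M) ≠ 0 := mul_ne_zero (pow_ne_zero _ hX0) (zpow_ne_zero _ hq0)
  apply mul_left_cancel₀ hne
  calc X ^ M * q ^ (-(M : ℤ) * M) * (X * S * T)
      = -((-1 : ℂ) ^ (M + 1) * (-1) ^ M * (q ^ (-tri M) * q ^ tri M)
        * (X ^ (M + 1) * q ^ (-(M : ℤ) * M) * S * T)) := by rw [e5, e6]; ring
    _ = -(X ^ M * q ^ (-(M : ℤ) * M)) := by rw [hpf]; ring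
    _ = _ := by ring

/-- Tannery's theorem: bounded weights with a common limit `L` may be replaced by `L` under an
absolutely convergent sum. -/
lemma tendsto_sum_Ico_mul {c : ℤ → ℂ} (hc : Summable c) {a : ℕ → ℤ} (ha : Tendsto a atTop atBot)
    {w : ℕ → ℤ → ℂ} {B : ℝ} {L : ℂ} (hw : ∀ M i, ‖w M i‖ ≤ B)
    (hl : ∀ i, Tendsto (fun M => w M i) atTop (𝓝 L)) :
    Tendsto (fun M : ℕ => ∑ i ∈ Finset.Ico (a M) (M + 1), c i * w M i) atTop
      (𝓝 ((∑' i, c i) * L)) := by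
  classical
  have hsum : ∀ M : ℕ, ∑ i ∈ Finset.Ico (a M) (M + 1), c i * w M i
      = ∑' i, if i ∈ Finset.Ico (a M) ((M : ℤ) + 1) then c i * w M i else 0 := fun M => by
    rw [tsum_eq_sum (s := Finset.Ico (a M) ((M : ℤ) + 1)) fun b hb => if_neg hb]
    exact Finset.sum_congr rfl fun i hi => (if_pos hi).symm
  simp only [hsum]
  rw [← tsum_mul_right]
  refine tendsto_tsum_of_dominated_convergence (bound := fun i => ‖c i‖ * B)
    (hc.norm.mul_right B) (fun i => ?_) (Eventually.of_forall fun M i => ?_)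
  · refine ((hl i).const_mul (c i)).congr' ?_
    filter_upwards [ha.eventually_le_atBot i,
      (tendsto_natCast_atTop_atTop (R := ℤ)).eventually_ge_atTop i] with M h1 h2
    rw [if_pos (Finset.mem_Ico.mpr ⟨h1, by omega⟩)]
  · split_ifs
    · rw [norm_mul]; gcongr; exact hw M i
    · rw [norm_zero]
      exact mul_nonneg (norm_nonneg _) ((norm_nonneg _).trans (hw M i))

lemma tendsto_qFact {q : ℂ} (hq : ‖q‖ < 1) :
    Tendsto (qFact q) atTop (𝓝 (∏' i : ℕ, (1 - q ^ (i + 1)))) :=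
  (ModularForm.multipliable_one_sub_pow hq).hasProd.tendsto_prod_nat

lemma tprod_one_sub_pow_ne_zero {q : ℂ} (hq : ‖q‖ < 1) : ∏' i : ℕ, (1 - q ^ (i + 1)) ≠ 0 := by
  have := tprod_one_add_ne_zero_of_summable (f := fun n : ℕ => -q ^ (n + 1))
    (fun i => by rw [← sub_eq_add_neg]; exact one_sub_pow_ne_zero hq i)
    (by simpa using (summable_nat_add_iff 1).mpr (summable_geometric_of_lt_one (norm_nonneg _) hq))
  simpa [← sub_eq_add_neg] using this

lemma exists_norm_qFact_le {q : ℂ} (hq : ‖q‖ < 1) :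
    ∃ B : ℝ, 0 ≤ B ∧ ∀ k, ‖qFact q k‖ ≤ B ∧ ‖(qFact q k)⁻¹‖ ≤ B := by
  obtain ⟨B₁, h₁⟩ := (tendsto_qFact hq).norm.bddAbove_range
  obtain ⟨B₂, h₂⟩ := ((tendsto_qFact hq).inv₀ (tprod_one_sub_pow_ne_zero hq)).norm.bddAbove_range
  exact ⟨max 0 (max B₁ B₂), le_max_left _ _, fun k =>
    ⟨(h₁ (Set.mem_range_self k)).trans ((le_max_left _ _).trans (le_max_right _ _)),
     (h₂ (Set.mem_range_self k)).trans ((le_max_right _ _).trans (le_max_right _ _))⟩⟩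

lemma norm_ee_lt_one {τ : ℂ} (hτ : 0 < τ.im) : ‖ee τ‖ < 1 := by
  rw [norm_ee, Real.exp_lt_one_iff]
  have := Real.pi_pos
  nlinarith [mul_pos this hτ]

lemma ee_zpow (τ : ℂ) (n : ℤ) : ee τ ^ n = ee (n * τ) := (ee_int_mul n τ).symm

lemma tri_term_eq (τ z : ℂ) (n : ℤ) :
    ee τ ^ tri n * ee z ^ n = ee (τ * ((1 / 2 : ℝ) * (n : ℂ) ^ 2) + n * (τ / 2 + z) + 0) := by
  rw [ee_zpow, ee_zpow, ← ee_add, cast_tri]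
  congr 1; push_cast; ring

lemma summable_tri_term {τ : ℂ} (hτ : 0 < τ.im) (z : ℂ) :
    Summable fun n : ℤ => (-1 : ℂ) ^ n * ee τ ^ tri n * ee z ^ n := by
  have h := summable_neg_one_zpow_mul (summable_ee_quadratic hτ (a := 1 / 2) (by norm_num) (τ / 2 + z) 0)
  refine h.congr fun n => ?_
  rw [mul_assoc, tri_term_eq]

lemma summable_tri_div {τ z : ℂ} (hτ : 0 < τ.im) (hz : OffLattice τ z) :
    Summable fun n : ℤ => (-1 : ℂ) ^ n * ee τ ^ tri n / (1 - ee z * ee τ ^ n) := by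
  obtain ⟨C, hC, h⟩ := exists_norm_inv_one_sub_ee_le hτ hz
  have h0 := (summable_tri_term hτ 0).norm.mul_right C
  refine Summable.of_norm_bounded h0 fun n => ?_
  rw [div_eq_mul_inv, norm_mul, ee_zpow τ n, ← ee_add]
  simp only [ee_zero, one_zpow, mul_one]
  gcongr
  exact h n

/-- The product of a theta series and an Appell sum is constant. -/
lemma theta_mul_appell {τ z : ℂ} (hτ : 0 < τ.im) (hz : OffLattice τ z) :
    ee z * (∑' n : ℤ, (-1 : ℂ) ^ n * ee τ ^ tri n * ee z ^ n) *
      (∑' n : ℤ, (-1 : ℂ) ^ n * ee τ ^ tri n / (1 - ee z * ee τ ^ n))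
      = -(∏' i : ℕ, (1 - ee τ ^ (i + 1))) ^ 3 := by
  set q := ee τ with hqdef
  set X := ee z with hXdef
  set P := ∏' i : ℕ, (1 - q ^ (i + 1)) with hP
  have hq : ‖q‖ < 1 := norm_ee_lt_one hτ
  have hP0 : P ≠ 0 := tprod_one_sub_pow_ne_zero hq
  have hX : ∀ n : ℤ, 1 - X * q ^ n ≠ 0 := fun n => by
    rw [hqdef, ee_zpow, hXdef, ← ee_add]; exact ee_add_int_mul_ne_one hz n
  obtain ⟨B, hB0, hB⟩ := exists_norm_qFact_le hq
  have hcast : Tendsto (fun M : ℕ => (M : ℤ)) atTop atTop := tendsto_natCast_atTop_atTop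
  have hlim : ∀ {g : ℕ → ℤ}, (∃ c : ℤ, ∀ M : ℕ, (M : ℤ) + c ≤ g M) →
      Tendsto (fun M => qFact q (g M).toNat) atTop (𝓝 P) := by
    rintro g ⟨c, hg⟩
    refine (tendsto_qFact hq).comp ?_
    rw [tendsto_atTop]
    intro b
    filter_upwards [eventually_ge_atTop (b + c.natAbs)] with M hM
    have := hg M
    omega
  -- With `P` the infinite product, the weights tend to `P/P²` in this sum and to `1/P²` in the
  -- next. Together they give `P⁻³`, the origin of the cube of `η`.
  have h1 := tendsto_sum_Ico_mul (summable_tri_term hτ z) (a := fun M => -((M : ℤ) + 1))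
    (w := fun M i => qFact q (2 * M + 1) / (qFact q (M + 1 + i).toNat * qFact q (M - i).toNat))
    (B := B * (B * B)) (L := P / (P * P))
    (by
      refine tendsto_neg_atTop_atBot.comp ?_
      exact tendsto_atTop_add_const_right _ _ hcast)
    (fun M i => by
      rw [div_eq_mul_inv, mul_inv, norm_mul, norm_mul]
      gcongr
      · exact (hB _).1
      · exact (hB _).2
      · exact (hB _).2)
    (fun i => by
      refine Tendsto.div ?_ (Tendsto.mul (hlim ⟨1 + i, fun M => by omega⟩)
        (hlim ⟨-i, fun M => by omega⟩)) (mul_ne_zero hP0 hP0)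
      have := hlim (g := fun M => 2 * (M : ℤ) + 1) ⟨1, fun M => by omega⟩
      refine this.congr fun M => ?_
      rw [show (2 * (M : ℤ) + 1).toNat = 2 * M + 1 by omega])
  have h2 := tendsto_sum_Ico_mul (summable_tri_div hτ hz) (a := fun M => -(M : ℤ))
    (w := fun M i => (qFact q (M + i).toNat * qFact q (M - i).toNat)⁻¹)
    (B := B * B) (L := (P * P)⁻¹)
    (tendsto_neg_atTop_atBot.comp hcast)
    (fun M i => by
      rw [mul_inv, norm_mul]
      gcongr
      · exact (hB _).2
      · exact (hB _).2)
    (fun i => (Tendsto.mul (hlim ⟨i, fun M => by omega⟩)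
        (hlim ⟨-i, fun M => by omega⟩)).inv₀ (mul_ne_zero hP0 hP0))
  have h3 := ((h1.const_mul X).mul h2)
  have h4 := h3.congr (fun M => by
    have := finite_theta_mul_appell (ee_ne_zero τ) hq (ee_ne_zero z) hX M
    simpa only [div_eq_mul_inv, ← hqdef, ← hXdef] using this)
  have h5 := tendsto_nhds_unique h4 tendsto_const_nhds
  field_simp at h5
  linear_combination h5

lemma ee_quarter : ee (1 / 4) = I := by
  rw [ee, show 2 * (Real.pi : ℂ) * I * (1 / 4) = Real.pi / 2 * I by ring, Complex.exp_pi_div_two_mul_I]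

lemma vartheta11_eq (τ z : ℂ) :
    vartheta11 τ z = I * ee (τ / 8 + z / 2) *
      ∑' n : ℤ, (-1 : ℂ) ^ n * ee τ ^ tri n * ee z ^ n := by
  rw [vartheta11, ← tsum_mul_left]
  refine tsum_congr fun n => ?_
  conv_rhs => rw [mul_assoc ((-1 : ℂ) ^ n), ee_zpow, ee_zpow, ← ee_half_int, ← ee_quarter,
    ← ee_add, ← ee_add, ← ee_add, ← ee_add, ee, cast_tri]
  congr 1; ring

lemma eta_pow_three (τ : ℂ) :
    ModularForm.eta τ ^ 3 = ee (τ / 8) * (∏' i : ℕ, (1 - ee τ ^ (i + 1))) ^ 3 := by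
  rw [ModularForm.eta, mul_pow]
  congr 1
  · rw [Function.Periodic.qParam, ← Complex.exp_nat_mul, ee]
    congr 1; push_cast; ring
  · simp only [ModularForm.eta_q_eq_pow, ee]

/-- The odd function `e ^ (2 π i w) / (1 - e ^ (4 π i w))`. -/
noncomputable def cosec (w : ℂ) : ℂ := ee w / (1 - ee (2 * w))

/-- The Appell sum whose product with `ϑ₁₁` is constant. -/
noncomputable def appell (τ z : ℂ) : ℂ := ∑' j : ℤ, (-1 : ℂ) ^ j * ee (τ * (j : ℂ) ^ 2) * cosec (z + j * τ)

lemma appell_term_eq (τ z : ℂ) (j : ℤ) :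
    (-1 : ℂ) ^ j * ee (τ * (j : ℂ) ^ 2) * cosec (z + j * τ)
      = ee z * ((-1 : ℂ) ^ j * ee (2 * τ) ^ tri j / (1 - ee (2 * z) * ee (2 * τ) ^ j)) := by
  rw [cosec, ee_zpow, ee_zpow, ← ee_add, cast_tri,
    show 2 * (z + j * τ) = 2 * z + j * (2 * τ) by ring, ← mul_div_assoc, ← mul_div_assoc]
  congr 1
  rw [mul_assoc, ← ee_add, mul_left_comm, ← ee_add]
  congr 2; ring

lemma summable_appell {τ z : ℂ} (hτ : 0 < τ.im) (hz : OffLattice (2 * τ) (2 * z)) :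
    Summable fun j : ℤ => (-1 : ℂ) ^ j * ee (τ * (j : ℂ) ^ 2) * cosec (z + j * τ) := by
  simp only [appell_term_eq]
  exact (summable_tri_div (by simpa using hτ) hz).mul_left _

lemma appell_mul_vartheta11 {τ z : ℂ} (hτ : 0 < τ.im) (hz : OffLattice (2 * τ) (2 * z)) :
    appell τ z * vartheta11 (2 * τ) (2 * z) = -I * ModularForm.eta (2 * τ) ^ 3 := by
  have h := theta_mul_appell (τ := 2 * τ) (by simpa using hτ) hz
  rw [appell, vartheta11_eq, eta_pow_three]
  simp only [appell_term_eq]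
  rw [tsum_mul_left, ee_add]
  have h2 : ee (2 * z / 2) * ee z = ee (2 * z) := by rw [← ee_add]; congr 1; ring
  linear_combination (I * ee (2 * τ / 8)) * h + (I * ee (2 * τ / 8) * (∑' n : ℤ, (-1 : ℂ) ^ n * ee (2 * τ) ^ tri n / (1 - ee (2 * z) * ee (2 * τ) ^ n)) * (∑' n : ℤ, (-1 : ℂ) ^ n * ee (2 * τ) ^ tri n * ee (2 * z) ^ n)) * h2

/-- A factor of a nonzero constant: the product with the Appell sum equals `-P³`, so no count of
zeros is needed. -/
lemma vartheta11_ne_zero {τ z : ℂ} (hτ : 0 < τ.im) (hz : OffLattice τ z) : vartheta11 τ z ≠ 0 := by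
  have h := theta_mul_appell hτ hz
  rw [vartheta11_eq]
  refine mul_ne_zero (mul_ne_zero I_ne_zero (ee_ne_zero _)) fun h0 => ?_
  rw [h0, mul_zero, zero_mul, eq_comm, neg_eq_zero] at h
  exact tprod_one_sub_pow_ne_zero (norm_ee_lt_one hτ) (pow_eq_zero_iff (by norm_num) |>.mp h)

lemma vartheta11_add_one (τ z : ℂ) : vartheta11 τ (z + 1) = -vartheta11 τ z := by
  have h1 : ee 1 = 1 := by simpa using ee_int 1
  have h2 : ee (τ / 8 + (z + 1) / 2) = -ee (τ / 8 + z / 2) := by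
    rw [show τ / 8 + (z + 1) / 2 = (τ / 8 + z / 2) + 1 / 2 by ring, ee_add, ee_half]; ring
  rw [vartheta11_eq, vartheta11_eq, h2, ee_add z, h1, mul_one]
  ring

lemma vartheta11_add_tau (τ z : ℂ) :
    vartheta11 τ (z + τ) = -ee (-z - τ / 2) * vartheta11 τ z := by
  have h : ∑' n : ℤ, (-1 : ℂ) ^ n * ee τ ^ tri n * ee (z + τ) ^ n
      = -ee (-z - τ) * ∑' n : ℤ, (-1 : ℂ) ^ n * ee τ ^ tri n * ee z ^ n := by
    rw [← (Equiv.addRight (1 : ℤ)).tsum_eq (fun n : ℤ => (-1 : ℂ) ^ n * ee τ ^ tri n * ee z ^ n),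
      ← tsum_mul_left]
    refine tsum_congr fun n => ?_
    rw [Equiv.coe_addRight, zpow_add₀ (by norm_num), zpow_one]
    simp only [ee_zpow, cast_tri, mul_assoc, ← ee_add]
    simp only [mul_left_comm _ ((-1 : ℂ) ^ n), neg_mul, mul_neg, one_mul, neg_neg, ← ee_add]
    congr 2; push_cast; ring
  rw [vartheta11_eq, vartheta11_eq, h]
  have h2 : ee (τ / 8 + (z + τ) / 2) * ee (-z - τ) = ee (-z - τ / 2) * ee (τ / 8 + z / 2) := by
    rw [← ee_add, ← ee_add]; congr 1; ring
  linear_combination (-I * ∑' n : ℤ, (-1 : ℂ) ^ n * ee τ ^ tri n * ee z ^ n) * h2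

/-- The reflection `n ↦ -1 - n` fixes `tri n` and reverses the sign `(-1)^n`. -/
lemma vartheta11_zero (τ : ℂ) : vartheta11 τ 0 = 0 := by
  rw [vartheta11_eq]
  have h : ∑' n : ℤ, (-1 : ℂ) ^ n * ee τ ^ tri n * ee 0 ^ n
      = -∑' n : ℤ, (-1 : ℂ) ^ n * ee τ ^ tri n * ee 0 ^ n := by
    rw [← tsum_neg, ← (Equiv.subLeft (-1 : ℤ)).tsum_eq
      (fun n : ℤ => (-1 : ℂ) ^ n * ee τ ^ tri n * ee 0 ^ n)]
    refine tsum_congr fun n => ?_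
    rw [Equiv.subLeft_apply, show tri (-1 - n) = tri n by
      rw [tri, tri]; congr 1; ring, zpow_sub₀ (by norm_num), zpow_neg_one]
    have : ((-1 : ℂ) ^ n)⁻¹ = (-1) ^ n := by rw [← inv_zpow]; norm_num
    rw [div_eq_mul_inv, this]
    simp
  rw [self_eq_neg.mp h, mul_zero]

lemma vartheta11_lattice (τ : ℂ) (a b : ℤ) : vartheta11 τ (a + b * τ) = 0 := by
  have h1 : ∀ z, vartheta11 τ z = 0 ↔ vartheta11 τ (z + 1) = 0 := fun z => by
    rw [vartheta11_add_one, neg_eq_zero]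
  have h2 : ∀ z, vartheta11 τ z = 0 ↔ vartheta11 τ (z + τ) = 0 := fun z => by
    rw [vartheta11_add_tau, neg_mul, neg_eq_zero, mul_eq_zero, or_iff_right (ee_ne_zero _)]
  have h3 : vartheta11 τ a = 0 := by
    induction a using Int.induction_on with
    | zero => simpa using vartheta11_zero τ
    | succ n ih => push_cast at ih ⊢; exact (h1 _).mp ih
    | pred n ih =>
      refine (h1 _).mpr ?_
      push_cast at ih ⊢
      rwa [sub_add_cancel]
  induction b using Int.induction_on with
  | zero => simpa using h3
  | succ n ih =>
    push_cast at ih ⊢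
    rw [show (a : ℂ) + (n + 1) * τ = a + n * τ + τ by ring]; exact (h2 _).mp ih
  | pred n ih =>
    refine (h2 _).mpr ?_
    push_cast at ih ⊢
    rwa [show (a : ℂ) + (-n - 1) * τ + τ = a + -n * τ by ring]

lemma vartheta11_ne_zero_iff {τ : ℂ} (hτ : 0 < τ.im) (z : ℂ) : vartheta11 τ z ≠ 0 ↔ OffLattice τ z :=
  ⟨fun h a b hz => h (hz ▸ vartheta11_lattice τ a b), vartheta11_ne_zero hτ⟩

/-! ### Theta functions in terms of the normalized exponential -/

lemma thetaMinus_eq {m : ℂ} (hm : m ≠ 0) (k τ z : ℂ) :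
    thetaMinus k m τ z = ee (k * z / 2 + τ * k ^ 2 / (4 * m)) *
      ∑' j : ℤ, (-1 : ℂ) ^ j * ee (j * (m * z + τ * k) + τ * m * (j : ℂ) ^ 2) := by
  rw [thetaMinus, ← tsum_mul_left]
  refine tsum_congr fun j => ?_
  rw [qPow_eq, mul_left_comm (ee _), ← ee_add, mul_assoc]
  congr 1
  rw [show 2 * (Real.pi : ℂ) * I * m * (j + k / (2 * m)) * z
    = 2 * (Real.pi : ℂ) * I * (m * (j + k / (2 * m)) * z) by ring]
  change ee _ * _ = _
  rw [← ee_add]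
  congr 1
  field_simp
  ring

lemma theta_eq {m : ℂ} (hm : m ≠ 0) (k τ z : ℂ) :
    theta k m τ z = ee (k * z / 2 + τ * k ^ 2 / (4 * m)) *
      ∑' j : ℤ, ee (j * (m * z + τ * k) + τ * m * (j : ℂ) ^ 2) := by
  rw [theta, ← tsum_mul_left]
  refine tsum_congr fun j => ?_
  rw [qPow_eq, ← ee_add]
  rw [show 2 * (Real.pi : ℂ) * I * m * (j + k / (2 * m)) * z
    = 2 * (Real.pi : ℂ) * I * (m * (j + k / (2 * m)) * z) by ring]
  change ee _ * _ = _
  rw [← ee_add]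
  congr 1
  field_simp
  ring

/-- For integral `m` the alternating series is, up to an exponential factor, `ϑ₁₁` with modulus
`2mτ` at the indicated argument. -/
lemma thetaMinus_ne_zero {m : ℕ} (hm : 0 < m) {k τ z : ℂ} (hτ : 0 < τ.im)
    (h : OffLattice (2 * m * τ) (m * z + τ * k - m * τ)) : thetaMinus k m τ z ≠ 0 := by
  have hm' : (m : ℂ) ≠ 0 := by exact_mod_cast hm.ne'
  have him : 0 < (2 * m * τ).im := by
    have : (2 * m * τ : ℂ) = ((2 * m : ℝ) : ℂ) * τ := by push_cast; ring
    rw [this, Complex.im_ofReal_mul]; positivity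
  rw [thetaMinus_eq hm']
  refine mul_ne_zero (ee_ne_zero _) ?_
  have h1 := vartheta11_ne_zero him h
  rw [vartheta11_eq] at h1
  have h2 := right_ne_zero_of_mul h1
  convert h2 using 3 with j
  rw [mul_assoc ((-1 : ℂ) ^ j), ee_zpow, ee_zpow, ← ee_add, cast_tri]
  congr 2; ring

/-! ### Density of the domain of the explicit formula -/

/-- Each lattice point excludes a fibre of a nonzero linear form. Such a form is an open map, so the
complement of a fibre is open and dense, and there are countably many lattice points. -/
lemma eventually_residual_offLattice {α β : ℂ} (h : α ≠ 0 ∨ β ≠ 0) (τ c : ℂ) :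
    ∀ᶠ z : ℂ × ℂ in residual (ℂ × ℂ), OffLattice τ (α * z.1 + β * z.2 + c) := by
  unfold OffLattice
  rw [eventually_countable_forall]
  intro a
  rw [eventually_countable_forall]
  intro b
  let f : ℂ × ℂ →L[ℂ] ℂ := α • ContinuousLinearMap.fst ℂ ℂ ℂ + β • ContinuousLinearMap.snd ℂ ℂ ℂ
  have hf : ∀ z : ℂ × ℂ, f z = α * z.1 + β * z.2 := fun z => by simp [f]
  have hf0 : f ≠ 0 := by
    intro h0
    rcases h with h | h
    · apply h; simpa [h0] using (hf (1, 0)).symm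
    · apply h; simpa [h0] using (hf (0, 1)).symm
  have hopen : IsOpenMap f := f.isOpenMap_of_ne_zero hf0
  have hs : {z : ℂ × ℂ | α * z.1 + β * z.2 + c ≠ a + b * τ} = f ⁻¹' {(a + b * τ - c : ℂ)}ᶜ := by
    ext z
    simp only [Set.mem_ofPred_eq, Set.mem_preimage, Set.mem_compl_iff, Set.mem_singleton_iff, hf,
      eq_sub_iff_add_eq, ne_eq]
  change {z : ℂ × ℂ | α * z.1 + β * z.2 + c ≠ a + b * τ} ∈ residual _
  rw [hs]
  exact residual_of_dense_open (isOpen_compl_singleton.preimage f.continuous)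
    ((dense_compl_singleton _).preimage hopen)

lemma eventually_residual_vartheta11 {τ c : ℂ} (hτ : 0 < τ.im) (hc : c ≠ 0) :
    ∀ᶠ z : ℂ × ℂ in residual (ℂ × ℂ),
      vartheta11 (2 * τ) (2 * (c * z.1)) ≠ 0 ∧ vartheta11 (2 * τ) (2 * (c * z.2)) ≠ 0 := by
  filter_upwards [eventually_residual_offLattice (α := 2 * c) (β := 0) (Or.inl (by simpa)) (2 * τ) 0,
    eventually_residual_offLattice (α := 0) (β := 2 * c) (Or.inr (by simpa)) (2 * τ) 0] with z h1 h2
  have hτ' : 0 < (2 * τ).im := by simpa using hτ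
  exact ⟨vartheta11_ne_zero hτ' (by simpa [mul_assoc] using h1),
    vartheta11_ne_zero hτ' (by simpa [mul_assoc] using h2)⟩

lemma eventually_residual_thetaMinus {N : ℕ} (hN : 0 < N) {τ c : ℂ} (hτ : 0 < τ.im) (hc : c ≠ 0)
    (k : ℂ) : ∀ᶠ z : ℂ × ℂ in residual (ℂ × ℂ),
      thetaMinus k (N + 1) τ (N * (c * z.1 - c * z.2) / (N + 1)) ≠ 0 := by
  have hN' : (N : ℂ) ≠ 0 := by exact_mod_cast hN.ne'
  have hN1 : (N : ℂ) + 1 ≠ 0 := by exact_mod_cast N.succ_ne_zero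
  filter_upwards [eventually_residual_offLattice (α := N * c) (β := -(N * c))
    (Or.inl (mul_ne_zero hN' hc)) (2 * (N + 1) * τ) (τ * k - (N + 1) * τ)] with z h
  have := thetaMinus_ne_zero (m := N + 1) (by omega) (k := k)
    (z := N * (c * z.1 - c * z.2) / (N + 1)) hτ (by
      push_cast
      convert h using 1
      field_simp
      ring)
  simpa using this

lemma eventually_residual_halfRegular {N : ℕ} (hN : 0 < N) {τ c : ℂ} (hτ : 0 < τ.im) (hc : c ≠ 0) :
    ∀ᶠ z : ℂ × ℂ in residual (ℂ × ℂ), HalfRegular N τ (c * z.1) (c * z.2) := by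
  filter_upwards [eventually_residual_thetaMinus hN hτ hc 0,
    eventually_residual_vartheta11 hτ hc] with z h1 h2
  exact ⟨h1, h2⟩

lemma eventually_residual_intRegular {N : ℕ} (hN : 0 < N) {τ c : ℂ} (hτ : 0 < τ.im) (hc : c ≠ 0) :
    ∀ᶠ z : ℂ × ℂ in residual (ℂ × ℂ), IntRegular N τ (c * z.1) (c * z.2) := by
  filter_upwards [eventually_residual_thetaMinus hN hτ hc (-N),
    eventually_residual_vartheta11 hτ hc] with z h1 h2
  exact ⟨h1, h2⟩

lemma two_pow_mul_div_two_im_pos {τ : ℂ} (hτ : 0 < τ.im) (p : ℕ) : 0 < (2 ^ p * τ / 2).im := by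
  have : (2 ^ p * τ / 2 : ℂ) = ((2 ^ p / 2 : ℝ) : ℂ) * τ := by push_cast; ring
  rw [this, Complex.im_ofReal_mul]; positivity

lemma two_pow_mul_im_pos {τ : ℂ} (hτ : 0 < τ.im) (p : ℕ) : 0 < (2 ^ p * τ).im := by
  have : (2 ^ p * τ : ℂ) = ((2 ^ p : ℝ) : ℂ) * τ := by push_cast; ring
  rw [this, Complex.im_ofReal_mul]; positivity

lemma div_two_pow_pos {N i : ℕ} (hN : 0 < N) (hi : i ≤ padicValNat 2 N) : 0 < N / 2 ^ i :=
  Nat.div_pos (Nat.le_of_dvd hN ((pow_dvd_pow 2 hi).trans pow_padicValNat_dvd)) (by positivity)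

lemma dense_explicitDomain {N : ℕ} (hN : 0 < N) (S : ℤ) {τ : ℂ} (hτ : 0 < τ.im) :
    Dense (explicitDomain N S τ) := by
  apply dense_of_mem_residual
  by_cases hS : Even S
  · simp only [explicitDomain, hS, if_true]
    have h1 := eventually_residual_intRegular (div_two_pow_pos hN le_rfl)
      (two_pow_mul_div_two_im_pos hτ (padicValNat 2 N)) (c := 2 ^ padicValNat 2 N / 2) (by simp)
    have h2 : ∀ᶠ z : ℂ × ℂ in residual (ℂ × ℂ), ∀ i ∈ Finset.range (padicValNat 2 N),
        HalfRegular (N / 2 ^ (i + 1)) (2 ^ i * τ) (2 ^ i * z.1) (2 ^ i * z.2) :=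
      (Finset.eventually_all _).mpr fun i hi => eventually_residual_halfRegular
        (div_two_pow_pos hN (Finset.mem_range.mp hi)) (two_pow_mul_im_pos hτ i) (by simp)
    filter_upwards [h1, h2] with z hz1 hz2
    refine ⟨?_, hz2⟩
    rwa [div_mul_eq_mul_div, div_mul_eq_mul_div] at hz1
  · simp only [explicitDomain, hS, if_false]
    have hτ2 : 0 < (τ / 2).im := by simpa using two_pow_mul_div_two_im_pos hτ 0
    filter_upwards [eventually_residual_halfRegular hN hτ2 (c := 1 / 2) (by norm_num)] with z hz
    rwa [one_div_mul_eq_div, one_div_mul_eq_div] at hz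

/-! ### The product of a theta function and an Appell sum -/

/-- The indicator of `b < n`, for half-integers `b + 1/2` and integers `n`. -/
noncomputable def below (b n : ℤ) : ℂ := if b < n then 1 else 0

lemma below_succ (b n : ℤ) : below b (n + 1) = below b n + if b = n then 1 else 0 := by
  simp only [below]
  split_ifs <;> first | omega | simp

/-- A geometric sum with orientation: the difference of indicators is `1` on `A ≤ b < B` and `-1` on
`B ≤ b < A`, so one formula covers both orders of the endpoints. -/
lemma hasSum_below_sub_below {X : ℂ} (h0 : X ≠ 0) (h1 : 1 - X ^ 2 ≠ 0) (A B : ℤ) :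
    HasSum (fun b : ℤ => (below b B - below b A) * X ^ (2 * b + 1))
      (X * (X ^ (2 * A) - X ^ (2 * B)) / (1 - X ^ 2)) := by
  have step : ∀ n : ℤ, X * (X ^ (2 * A) - X ^ (2 * (n + 1))) / (1 - X ^ 2)
      = X * (X ^ (2 * A) - X ^ (2 * n)) / (1 - X ^ 2) + X ^ (2 * n + 1) := fun n => by
    rw [mul_add, mul_one, zpow_add₀ h0 (2 * n) 2, zpow_add₀ h0 (2 * n) 1, zpow_one]
    have : X ^ (2 : ℤ) = X ^ 2 := by norm_cast
    rw [this]
    field_simp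
    ring
  have hs : ∀ n : ℤ, HasSum (fun b : ℤ => if b = n then X ^ (2 * n + 1) else 0)
      (X ^ (2 * n + 1)) := fun n => hasSum_ite_eq n _
  induction B using Int.inductionOn' (b := A) with
  | zero => simp
  | succ k _ ih =>
    rw [step]
    refine (ih.add (hs k)).congr_fun ?_
    intro b
    rw [below_succ]
    split_ifs with h
    · rw [h]; ring
    · ring
  | pred k _ ih =>
    have h2 := step (k - 1)
    rw [sub_add_cancel] at h2
    rw [eq_sub_of_add_eq h2.symm]
    refine (ih.sub (hs (k - 1))).congr_fun ?_
    intro b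
    have h3 := below_succ b (k - 1)
    rw [sub_add_cancel] at h3
    rw [h3]
    split_ifs with h
    · rw [h]; ring
    · ring

/-- The general term of the indefinite theta series, with `d = z₁ - z₂` and `u = z₁ + z₂`. -/
noncomputable def coreTerm (N : ℕ) (τ d u : ℂ) (J l b : ℤ) : ℂ :=
  (-1) ^ J * ee (τ * ((J : ℂ) ^ 2 + (2 * b + 1) * (J + l) + N * (l : ℂ) ^ 2)
    + (b + 1 / 2) * d + (b + 1 / 2 + N * l) * u)

/-- The right side is affine in `β`, so a bound at both endpoints holds in between. -/
lemma quadratic_lower_bound {c p s A M β : ℝ} (hA : c ≤ p + 2 * A * s) (hM : c ≤ p + 2 * M * s)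
    (h : A ≤ β ∧ β ≤ M ∨ M ≤ β ∧ β ≤ A) : c ≤ p + 2 * β * s := by
  rcases h with ⟨h1, h2⟩ | ⟨h1, h2⟩ <;> rcases le_total 0 s with hs | hs <;> nlinarith

lemma below_sub_below_eq_zero_or (b A M : ℤ) :
    below b A - below b M = 0 ∨ (‖below b A - below b M‖ = 1 ∧ (A ≤ b ∧ b < M ∨ M ≤ b ∧ b < A)) := by
  unfold below
  split_ifs <;> simp <;> omega

/-- The exponent of `q` is indefinite in `(J, l, b)`, but it is affine in `b` and at least `(J² +
l²)/3` at both ends of the range of `b + 1/2`. The choices `A = id` and `A = 0` are the endpoints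
before and after `tsum_below_id_eq`. -/
lemma summable_coreTerm {N : ℕ} (hN : 0 < N) {τ : ℂ} (hτ : 0 < τ.im) (d u : ℂ) {A : ℤ → ℤ}
    (hA : A = id ∨ A = 0) :
    Summable fun p : ℤ × ℤ × ℤ =>
      (below p.2.2 (A p.2.1) - below p.2.2 (N * p.1)) * coreTerm N τ d u p.1 p.2.1 p.2.2 := by
  have hN1 : (1 : ℝ) ≤ N := by exact_mod_cast hN
  set K : ℝ := 2 * Real.pi * (|d.im| + |u.im|) with hK
  have hK0 : 0 ≤ K := by positivity
  -- On the support `b² ≤ 2N²(J² + l²)`, so `J² + l² + b²` is at most `3(1 + 2N²)` times the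
  -- exponent of `q`.
  refine Summable.of_norm_bounded ((summable_gauss_three
    (a := 2 * Real.pi * τ.im / (3 * (1 + 2 * (N : ℝ) ^ 2))) (by positivity) (K * N)).mul_left
      (Real.exp K)) ?_
  rintro ⟨J, l, b⟩
  simp only
  rcases below_sub_below_eq_zero_or b (A l) (N * J) with h | ⟨hn, hb⟩
  · rw [h, zero_mul, norm_zero]; positivity
  · have hAl : |((A l : ℤ) : ℝ)| ≤ |(l : ℝ)| := by rcases hA with rfl | rfl <;> simp
    have hb1 : ((A l : ℤ) : ℝ) ≤ b ∧ (b : ℝ) + 1 ≤ N * J ∨ (N : ℝ) * J ≤ b ∧ (b : ℝ) + 1 ≤ (A l : ℤ) := by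
      rcases hb with ⟨h1, h2⟩ | ⟨h1, h2⟩
      · left; constructor <;> [exact_mod_cast h1; exact_mod_cast h2]
      · right; constructor <;> [exact_mod_cast h1; exact_mod_cast h2]
    have hQA : ((J : ℝ) ^ 2 + (l : ℝ) ^ 2) / 3
        ≤ ((J : ℝ) ^ 2 + N * (l : ℝ) ^ 2) + 2 * ((A l : ℤ) : ℝ) * (J + l) := by
      rcases hA with rfl | rfl
      · simp only [id]
        nlinarith [sq_nonneg ((J : ℝ) + (3 / 2) * l), mul_nonneg (sub_nonneg.mpr hN1) (sq_nonneg (l : ℝ))]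
      · simp only [Pi.zero_apply, Int.cast_zero]
        nlinarith [sq_nonneg (J : ℝ), sq_nonneg (l : ℝ),
          mul_nonneg (sub_nonneg.mpr hN1) (sq_nonneg (l : ℝ))]
    have hQM : ((J : ℝ) ^ 2 + (l : ℝ) ^ 2) / 3
        ≤ ((J : ℝ) ^ 2 + N * (l : ℝ) ^ 2) + 2 * ((N : ℝ) * J) * (J + l) := by
      nlinarith [sq_nonneg ((l : ℝ) + (3 / 2) * J), mul_nonneg (sub_nonneg.mpr hN1)
        (add_nonneg (sq_nonneg ((J : ℝ) + l)) (sq_nonneg (J : ℝ)))]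
    have hQ := quadratic_lower_bound (β := (b : ℝ) + 1 / 2) hQA hQM (by
      rcases hb1 with ⟨h1, h2⟩ | ⟨h1, h2⟩
      · left; constructor <;> linarith
      · right; constructor <;> linarith)
    have habs : |(b : ℝ)| ≤ |(l : ℝ)| + N * |(J : ℝ)| := by
      have e1 := abs_le.mp hAl
      have e2 : |(N : ℝ) * J| = N * |(J : ℝ)| := by rw [abs_mul, abs_of_pos (by linarith)]
      have e3 := abs_le.mp e2.le
      have e4 := abs_nonneg (l : ℝ)
      have e5 : 0 ≤ (N : ℝ) * |(J : ℝ)| := by positivity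
      rw [abs_le]
      rcases hb1 with ⟨h1, h2⟩ | ⟨h1, h2⟩ <;> constructor <;> linarith
    have hbsq : (b : ℝ) ^ 2 ≤ 2 * (N : ℝ) ^ 2 * ((J : ℝ) ^ 2 + (l : ℝ) ^ 2) := by
      have e1 : (b : ℝ) ^ 2 ≤ (|(l : ℝ)| + N * |(J : ℝ)|) ^ 2 := by
        rw [← sq_abs (b : ℝ)]; gcongr
      have e2 : (|(l : ℝ)| + N * |(J : ℝ)|) ^ 2 ≤ 2 * (|(l : ℝ)| ^ 2 + (N * |(J : ℝ)|) ^ 2) := by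
        nlinarith [sq_nonneg (|(l : ℝ)| - N * |(J : ℝ)|)]
      rw [mul_pow, sq_abs, sq_abs] at e2
      have e3 : (l : ℝ) ^ 2 ≤ (N : ℝ) ^ 2 * (l : ℝ) ^ 2 := by
        nlinarith [mul_nonneg (sub_nonneg.mpr (one_le_pow₀ hN1 (n := 2))) (sq_nonneg (l : ℝ))]
      nlinarith
    rw [norm_mul, hn, one_mul, coreTerm, norm_mul, norm_neg_one_zpow, one_mul]
    have hnorm := norm_ee_comb_le τ d u
      ((J : ℝ) ^ 2 + N * (l : ℝ) ^ 2 + 2 * ((b : ℝ) + 1 / 2) * (J + l))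
      ((b : ℝ) + 1 / 2) ((b : ℝ) + 1 / 2 + N * l) (1 + N * (|(J : ℝ)| + |(l : ℝ)| + |(b : ℝ)|))
      (by
        have e1 : |(b : ℝ) + 1 / 2| ≤ |(b : ℝ)| + 1 / 2 := by
          refine (abs_add_le _ _).trans ?_; norm_num
        have e2 : |(b : ℝ)| ≤ N * |(b : ℝ)| := le_mul_of_one_le_left (abs_nonneg _) hN1
        have e3 : 0 ≤ (N : ℝ) * |(J : ℝ)| := by positivity
        have e4 : 0 ≤ (N : ℝ) * |(l : ℝ)| := by positivity
        linarith)
      (by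
        have e1 : |(b : ℝ) + 1 / 2 + N * l| ≤ |(b : ℝ)| + 1 / 2 + N * |(l : ℝ)| := by
          refine (abs_add_le _ _).trans (add_le_add ((abs_add_le _ _).trans ?_) ?_)
          · norm_num
          · rw [abs_mul, abs_of_pos (by linarith)]
        have e2 : |(b : ℝ)| ≤ N * |(b : ℝ)| := le_mul_of_one_le_left (abs_nonneg _) hN1
        have e3 : 0 ≤ (N : ℝ) * |(J : ℝ)| := by positivity
        linarith)
    rw [← Real.exp_add]
    refine (le_of_eq ?_).trans (hnorm.trans (Real.exp_le_exp.mpr ?_))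
    · congr 2; push_cast; ring
    · have e1 : 2 * Real.pi * τ.im / (3 * (1 + 2 * (N : ℝ) ^ 2))
          * ((J : ℝ) ^ 2 + (l : ℝ) ^ 2 + (b : ℝ) ^ 2) ≤ 2 * Real.pi * τ.im *
            ((J : ℝ) ^ 2 + N * (l : ℝ) ^ 2 + 2 * ((b : ℝ) + 1 / 2) * (J + l)) := by
        rw [div_mul_eq_mul_div, mul_div_assoc]
        refine mul_le_mul_of_nonneg_left ?_ (by positivity)
        rw [div_le_iff₀ (by positivity)]
        nlinarith
      rw [← hK]
      linarith

/-- The series whose product with a theta function is an indefinite theta series. -/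
noncomputable def thetaAppell (N : ℕ) (τ z₁ z₂ : ℂ) : ℂ :=
  ∑' j : ℤ, ee (τ * N * (j : ℂ) ^ 2 + N * j * (z₁ + z₂)) * cosec (z₁ + j * τ)

lemma exists_norm_cosec_le {τ z : ℂ} (hτ : 0 < τ.im) (hz : OffLattice (2 * τ) (2 * z)) :
    ∃ C : ℝ, 0 ≤ C ∧ ∀ j : ℤ, ‖cosec (z + j * τ)‖ ≤ C * ‖ee (j * τ + z)‖ := by
  obtain ⟨C, hC, h⟩ := exists_norm_inv_one_sub_ee_le (τ := 2 * τ) (by simpa using hτ) hz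
  refine ⟨C, hC, fun j => ?_⟩
  have := h j
  rw [cosec, div_eq_mul_inv, norm_mul, mul_comm, add_comm z,
    show 2 * (j * τ + z) = 2 * z + j * (2 * τ) by ring]
  gcongr

lemma summable_thetaAppell {N : ℕ} (hN : 0 < N) {τ z₁ : ℂ} (hτ : 0 < τ.im)
    (hz : OffLattice (2 * τ) (2 * z₁)) (z₂ : ℂ) :
    Summable fun j : ℤ => ee (τ * N * (j : ℂ) ^ 2 + N * j * (z₁ + z₂)) * cosec (z₁ + j * τ) := by
  obtain ⟨C, hC, h⟩ := exists_norm_cosec_le hτ hz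
  have hN1 : (0 : ℝ) < N := by exact_mod_cast hN
  refine Summable.of_norm_bounded
    ((summable_ee_quadratic hτ hN1 (N * (z₁ + z₂) + τ) z₁).norm.mul_left C) fun j => ?_
  rw [norm_mul]
  calc _ ≤ ‖ee (τ * N * (j : ℂ) ^ 2 + N * j * (z₁ + z₂))‖ * (C * ‖ee (j * τ + z₁)‖) := by
        gcongr; exact h j
    _ = C * ‖ee (τ * N * (j : ℂ) ^ 2 + N * j * (z₁ + z₂)) * ee (j * τ + z₁)‖ := by
        rw [norm_mul]; ring
    _ = _ := by
        rw [← ee_add]; congr 3; push_cast; ring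

lemma summable_alternating {τ : ℂ} (hτ : 0 < τ.im) {m : ℕ} (hm : 0 < m) (z : ℂ) :
    Summable fun j : ℤ => (-1 : ℂ) ^ j * ee (j * z + τ * m * (j : ℂ) ^ 2) := by
  have hm1 : (0 : ℝ) < m := by exact_mod_cast hm
  refine (summable_neg_one_zpow_mul (summable_ee_quadratic hτ hm1 z 0)).congr fun j => ?_
  congr 2; push_cast; ring

lemma thetaMinus_zero_eq (N : ℕ) (τ z : ℂ) :
    thetaMinus 0 (N + 1) τ (z / (N + 1))
      = ∑' j : ℤ, (-1 : ℂ) ^ j * ee (j * z + τ * (N + 1 : ℕ) * (j : ℂ) ^ 2) := by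
  have hN1 : (N : ℂ) + 1 ≠ 0 := by exact_mod_cast N.succ_ne_zero
  rw [thetaMinus_eq hN1]
  have : ee (0 * (z / (N + 1)) / 2 + τ * 0 ^ 2 / (4 * ((N : ℂ) + 1))) = 1 := by simp
  rw [this, one_mul]
  refine tsum_congr fun j => ?_
  rw [mul_div_cancel₀ _ hN1]
  congr 2; push_cast; ring

/-- The equivalence `(J, l) ↦ (J, J + l)`. -/
def shearFst : ℤ × ℤ ≃ ℤ × ℤ where
  toFun p := (p.1, p.1 + p.2)
  invFun p := (p.1, p.2 - p.1)
  left_inv p := by ext <;> simp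
  right_inv p := by ext <;> simp

/-- The equivalence `(J, l) ↦ (l, J + l)`. -/
def shearSnd : ℤ × ℤ ≃ ℤ × ℤ where
  toFun p := (p.2, p.1 + p.2)
  invFun p := (p.2 - p.1, p.1)
  left_inv p := by ext <;> simp
  right_inv p := by ext <;> simp

/-- Both products contain `cosec w` with `w = z₁ + (J + l)τ`. Their other factors are a common one
times `ee w ^ (2NJ)` and `ee w ^ (2l)`, and the difference divided by `1 - ee w ^ 2` is a geometric
sum. -/
lemma core_identity {N : ℕ} {τ z₁ z₂ : ℂ} (hz : OffLattice (2 * τ) (2 * z₁)) (J l : ℤ) :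
    HasSum (fun b : ℤ => (below b l - below b (N * J)) * coreTerm N τ (z₁ - z₂) (z₁ + z₂) J l b)
      (((-1 : ℂ) ^ J * ee (J * (N * (z₁ - z₂)) + τ * (N + 1 : ℕ) * (J : ℂ) ^ 2)) *
        (ee (τ * N * ((J + l : ℤ) : ℂ) ^ 2 + N * (J + l : ℤ) * (z₁ + z₂)) *
          cosec (z₁ + (J + l : ℤ) * τ))
      - ((-1 : ℂ) ^ l * ee (l * (z₁ - z₂ + (N + 1) * (z₁ + z₂)) + τ * (N + 1 : ℕ) * (l : ℂ) ^ 2)) *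
        ((-1 : ℂ) ^ (J + l) * ee (τ * ((J + l : ℤ) : ℂ) ^ 2) * cosec (z₁ + (J + l : ℤ) * τ))) := by
  set w : ℂ := z₁ + (J + l : ℤ) * τ with hw
  have h1 : 1 - ee w ^ 2 ≠ 0 := by
    have h := ee_add_int_mul_ne_one hz (J + l)
    rw [show ee w ^ 2 = ee (2 * z₁ + (J + l : ℤ) * (2 * τ)) by
      rw [← ee_nat_mul]; congr 1; rw [hw]; push_cast; ring]
    exact h
  have hsum := (hasSum_below_sub_below (ee_ne_zero w) h1 (N * J) l).mul_left
    ((-1) ^ J * ee (τ * ((J : ℂ) ^ 2 + N * (l : ℂ) ^ 2) + N * l * (z₁ + z₂)))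
  have hc : cosec w = ee w / (1 - ee w ^ 2) := by
    rw [cosec, ← ee_nat_mul]; norm_num
  have hs : (-1 : ℂ) ^ l * (-1) ^ (J + l) = (-1) ^ J := by
    rw [← zpow_add₀ (by norm_num), show l + (J + l) = J + 2 * l by ring, zpow_add₀ (by norm_num),
      zpow_mul]
    norm_num
  have e1 : ee (J * (N * (z₁ - z₂)) + τ * (N + 1 : ℕ) * (J : ℂ) ^ 2) *
      ee (τ * N * ((J + l : ℤ) : ℂ) ^ 2 + N * (J + l : ℤ) * (z₁ + z₂))
      = ee (τ * ((J : ℂ) ^ 2 + N * (l : ℂ) ^ 2) + N * l * (z₁ + z₂)) * ee w ^ (2 * (N * J)) := by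
    rw [← ee_int_mul, ← ee_add, ← ee_add]; congr 1; rw [hw]; push_cast; ring
  have e2 : ee (l * (z₁ - z₂ + (N + 1) * (z₁ + z₂)) + τ * (N + 1 : ℕ) * (l : ℂ) ^ 2) *
      ee (τ * ((J + l : ℤ) : ℂ) ^ 2)
      = ee (τ * ((J : ℂ) ^ 2 + N * (l : ℂ) ^ 2) + N * l * (z₁ + z₂)) * ee w ^ (2 * l) := by
    rw [← ee_int_mul, ← ee_add, ← ee_add]; congr 1; rw [hw]; push_cast; ring
  have hval : (-1) ^ J * ee (τ * ((J : ℂ) ^ 2 + N * (l : ℂ) ^ 2) + N * l * (z₁ + z₂)) *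
        (ee w * (ee w ^ (2 * (N * J)) - ee w ^ (2 * l)) / (1 - ee w ^ 2))
      = (-1 : ℂ) ^ J * ee (J * (N * (z₁ - z₂)) + τ * (N + 1 : ℕ) * (J : ℂ) ^ 2) *
        (ee (τ * N * ((J + l : ℤ) : ℂ) ^ 2 + N * (J + l : ℤ) * (z₁ + z₂)) * cosec w)
      - (-1 : ℂ) ^ l * ee (l * (z₁ - z₂ + (N + 1) * (z₁ + z₂)) + τ * (N + 1 : ℕ) * (l : ℂ) ^ 2) *
        ((-1 : ℂ) ^ (J + l) * ee (τ * ((J + l : ℤ) : ℂ) ^ 2) * cosec w) := by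
    rw [hc]
    linear_combination (-((-1) ^ J * (ee w / (1 - ee w ^ 2)))) * e1
      + ((-1 : ℂ) ^ l * (-1) ^ (J + l) * (ee w / (1 - ee w ^ 2))) * e2
      + (ee (τ * ((J : ℂ) ^ 2 + N * (l : ℂ) ^ 2) + N * l * (z₁ + z₂)) *
        ee w ^ (2 * l) * (ee w / (1 - ee w ^ 2))) * hs
  rw [← hval]
  refine hsum.congr_fun fun b => ?_
  rw [coreTerm, ← ee_int_mul, mul_left_comm ((-1) ^ J * _), mul_assoc ((-1) ^ J), ← ee_add]
  congr 3
  rw [hw]; push_cast; ring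

lemma theta_mul_thetaAppell {N : ℕ} (hN : 0 < N) {τ z₁ z₂ : ℂ} (hτ : 0 < τ.im)
    (hz : OffLattice (2 * τ) (2 * z₁)) :
    thetaMinus 0 (N + 1) τ (N * (z₁ - z₂) / (N + 1)) * thetaAppell N τ z₁ z₂
      = thetaMinus 0 (N + 1) τ ((z₁ - z₂) / (N + 1) + z₁ + z₂) * appell τ z₁
        + ∑' p : ℤ × ℤ × ℤ, (below p.2.2 p.2.1 - below p.2.2 (N * p.1))
          * coreTerm N τ (z₁ - z₂) (z₁ + z₂) p.1 p.2.1 p.2.2 := by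
  have hN1 : (N : ℂ) + 1 ≠ 0 := by exact_mod_cast N.succ_ne_zero
  have hA := summable_alternating hτ N.succ_pos (N * (z₁ - z₂))
  have hB := summable_thetaAppell hN hτ hz z₂
  have hC := summable_alternating hτ N.succ_pos (z₁ - z₂ + (N + 1) * (z₁ + z₂))
  have hD := summable_appell hτ hz
  have hE := summable_coreTerm hN hτ (z₁ - z₂) (z₁ + z₂) (A := id) (Or.inl rfl)
  rw [show (z₁ - z₂) / (N + 1) + z₁ + z₂ = (z₁ - z₂ + (N + 1) * (z₁ + z₂)) / ((N : ℂ) + 1) by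
    field_simp; ring, thetaMinus_zero_eq, thetaMinus_zero_eq, thetaAppell, appell,
    tsum_mul_tsum_of_summable_norm hA.norm hB.norm, tsum_mul_tsum_of_summable_norm hC.norm hD.norm,
    ← sub_eq_iff_eq_add']
  -- In both double series the Appell index becomes `J + l`; the theta index is `J` in the first and
  -- `l` in the second.
  have hF := (shearFst.hasSum_iff.mpr (summable_mul_of_summable_norm hA.norm hB.norm).hasSum).sub
    (shearSnd.hasSum_iff.mpr (summable_mul_of_summable_norm hC.norm hD.norm).hasSum)
  rw [← hF.tsum_eq, ← (Equiv.prodAssoc ℤ ℤ ℤ).tsum_eq]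
  have hE' := (Equiv.prodAssoc ℤ ℤ ℤ).summable_iff.mpr hE
  simp only [Function.comp_def] at hE'
  refine Eq.trans ?_ hE'.tsum_prod.symm
  refine tsum_congr fun p => ?_
  exact (core_identity hz p.1 p.2).tsum_eq.symm

/-! ### Symmetrization of the indefinite theta series -/

lemma neg_one_zpow_neg (n : ℤ) : (-1 : ℂ) ^ (-n) = (-1) ^ n := by
  rw [zpow_neg, ← inv_zpow]; norm_num

/-- The difference of the two series has weight `below b l - below b 0`, independent of `J`. The
involution `J ↦ -(2b+1) - J` preserves `J² + (2b+1)J` and changes the parity of `J`, so this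
difference is its own negative. -/
lemma tsum_below_id_eq {N : ℕ} (hN : 0 < N) {τ : ℂ} (hτ : 0 < τ.im) (d u : ℂ) :
    ∑' p : ℤ × ℤ × ℤ, (below p.2.2 p.2.1 - below p.2.2 (N * p.1)) * coreTerm N τ d u p.1 p.2.1 p.2.2
      = ∑' p : ℤ × ℤ × ℤ,
        (below p.2.2 0 - below p.2.2 (N * p.1)) * coreTerm N τ d u p.1 p.2.1 p.2.2 := by
  have h1 := summable_coreTerm hN hτ d u (A := id) (Or.inl rfl)
  have h2 := summable_coreTerm hN hτ d u (A := 0) (Or.inr rfl)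
  simp only [id, Pi.zero_apply] at h1 h2
  rw [← sub_eq_zero, ← h1.tsum_sub h2]
  let σ : ℤ × ℤ × ℤ ≃ ℤ × ℤ × ℤ :=
    { toFun := fun p => (-(2 * p.2.2 + 1) - p.1, p.2.1, p.2.2)
      invFun := fun p => (-(2 * p.2.2 + 1) - p.1, p.2.1, p.2.2)
      left_inv := fun p => by ext <;> simp
      right_inv := fun p => by ext <;> simp }
  rw [← self_eq_neg, ← tsum_neg, ← σ.tsum_eq]
  refine tsum_congr fun p => ?_
  obtain ⟨J, l, b⟩ := p
  have hs : (-1 : ℂ) ^ (-(2 * b + 1) - J) = -(-1) ^ J := by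
    rw [show -(2 * b + 1) - J = -(2 * b + 1 + J) by ring, neg_one_zpow_neg,
      zpow_add₀ (by norm_num), zpow_add₀ (by norm_num), zpow_mul]
    norm_num
  have hc : coreTerm N τ d u (-(2 * b + 1) - J) l b = -coreTerm N τ d u J l b := by
    rw [coreTerm, coreTerm, hs, neg_mul]
    congr 3; push_cast; ring
  simp only [σ, Equiv.coe_fn_mk, hc]
  ring

/-- The sign and the exponential in the series obtained by summing `coreTerm` over `l`. -/
noncomputable def coreCoeff (N : ℕ) (τ d : ℂ) (J b : ℤ) : ℂ :=
  (below b 0 - below b (N * J)) * ((-1) ^ J *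
    ee (τ * ((J : ℂ) ^ 2 + (2 * b + 1) * J - (2 * b + 1) ^ 2 / (4 * N)) + (b + 1 / 2) * d))

/-- Completing the square in `l` produces the theta function and the exponent `-(2b+1)²/(4N)`. -/
lemma tsum_coreTerm {N : ℕ} (hN : 0 < N) (τ d u : ℂ) (J b : ℤ) :
    ∑' l : ℤ, (below b 0 - below b (N * J)) * coreTerm N τ d u J l b
      = coreCoeff N τ d J b * theta (2 * b + 1) N τ u := by
  have hN' : (N : ℂ) ≠ 0 := by exact_mod_cast hN.ne'
  rw [theta_eq hN', coreCoeff, tsum_mul_left, mul_assoc]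
  congr 1
  rw [← tsum_mul_left, ← tsum_mul_left]
  refine tsum_congr fun l => ?_
  rw [coreTerm, mul_assoc, ← ee_add, ← ee_add]
  congr 2
  field_simp
  ring

/-- Regrouping of triples `(J, l, b)` as `((J, b), l)`. -/
def regroup : (ℤ × ℤ) × ℤ ≃ ℤ × ℤ × ℤ where
  toFun p := (p.1.1, p.2, p.1.2)
  invFun p := ((p.1, p.2.2), p.2.1)
  left_inv _ := rfl
  right_inv _ := rfl

lemma hasSum_coreCoeff {N : ℕ} (hN : 0 < N) {τ : ℂ} (hτ : 0 < τ.im) (d u : ℂ) :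
    HasSum (fun p : ℤ × ℤ => coreCoeff N τ d p.1 p.2 * theta (2 * p.2 + 1) N τ u)
      (∑' p : ℤ × ℤ × ℤ, (below p.2.2 p.2.1 - below p.2.2 (N * p.1))
        * coreTerm N τ d u p.1 p.2.1 p.2.2) := by
  rw [tsum_below_id_eq hN hτ]
  have h2 := summable_coreTerm hN hτ d u (A := 0) (Or.inr rfl)
  simp only [Pi.zero_apply] at h2
  have h3 := regroup.hasSum_iff.mpr h2.hasSum
  have h4 := h3.summable
  refine (h3.prod_fiberwise fun p => ((h4.prod_factor p).hasSum)).congr_fun ?_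
  intro p
  exact (tsum_coreTerm hN τ d u p.1 p.2).symm

/-- The equivalence `(J, b) ↦ (-J, -1 - b)`. -/
def reflectPair : ℤ × ℤ ≃ ℤ × ℤ := (Equiv.neg ℤ).prodCongr (Equiv.subLeft (-1))

lemma coreCoeff_reflect (N : ℕ) (τ d : ℂ) (J b : ℤ) :
    coreCoeff N τ (-d) (-J) (-1 - b) = -coreCoeff N τ d J b := by
  have h : below (-1 - b) 0 - below (-1 - b) (N * -J) = -(below b 0 - below b (N * J)) := by
    have h1 : ∀ n : ℤ, below (-1 - b) (-n) = 1 - below b n := fun n => by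
      unfold below; split_ifs <;> first | omega | simp
    have h2 := h1 0
    rw [neg_zero] at h2
    rw [mul_neg, h1, h2]; ring
  rw [coreCoeff, coreCoeff, h, neg_one_zpow_neg, neg_mul]
  congr 5
  · push_cast; ring
  · push_cast; ring

/-- Exchanging `z₁` and `z₂` changes only the sign of `d`. The reflection `(J, b) ↦ (-J, -1 - b)`
undoes this at the cost of a sign and replaces `θ_{2b+1}` by `θ_{-(2b+1)}`. -/
lemma hasSum_symmetrized {N : ℕ} (hN : 0 < N) {τ : ℂ} (hτ : 0 < τ.im) (z₁ z₂ : ℂ) :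
    HasSum (fun p : ℤ × ℤ => coreCoeff N τ (z₁ - z₂) p.1 p.2 * thetaDiff (2 * p.2 + 1) N τ (z₁ + z₂))
      ((∑' p : ℤ × ℤ × ℤ, (below p.2.2 p.2.1 - below p.2.2 (N * p.1))
        * coreTerm N τ (z₁ - z₂) (z₁ + z₂) p.1 p.2.1 p.2.2)
      + ∑' p : ℤ × ℤ × ℤ, (below p.2.2 p.2.1 - below p.2.2 (N * p.1))
        * coreTerm N τ (z₂ - z₁) (z₂ + z₁) p.1 p.2.1 p.2.2) := by
  refine ((hasSum_coreCoeff hN hτ (z₁ - z₂) (z₁ + z₂)).add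
    (reflectPair.hasSum_iff.mpr (hasSum_coreCoeff hN hτ (z₂ - z₁) (z₂ + z₁)))).congr_fun ?_
  rintro ⟨J, b⟩
  have h := coreCoeff_reflect N τ (z₁ - z₂) J b
  rw [neg_sub] at h
  simp only [Function.comp, reflectPair, Equiv.prodCongr_apply, Prod.map, Equiv.neg_apply,
    Equiv.subLeft_apply, h, thetaDiff, add_comm z₂ z₁]
  rw [show (2 * ((-1 - b : ℤ) : ℂ) + 1) = -(2 * b + 1) by push_cast; ring]
  ring

/-! ### Periodicity in the characteristic -/

lemma theta_add_period {m : ℂ} (hm : m ≠ 0) (k τ z : ℂ) (n : ℤ) :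
    theta (k + 2 * m * n) m τ z = theta k m τ z := by
  rw [theta, theta, ← (Equiv.addRight n).tsum_eq (fun j : ℤ =>
    cexp (2 * (Real.pi : ℂ) * I * m * (j + k / (2 * m)) * z) * qPow τ (m * (j + k / (2 * m)) ^ 2))]
  refine tsum_congr fun j => ?_
  have : (j : ℂ) + (k + 2 * m * n) / (2 * m) = ((j + n : ℤ) : ℂ) + k / (2 * m) := by
    push_cast; field_simp; ring
  rw [this, Equiv.coe_addRight]

lemma thetaDiff_add_period {m : ℂ} (hm : m ≠ 0) (k τ z : ℂ) (n : ℤ) :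
    thetaDiff (k + 2 * m * n) m τ z = thetaDiff k m τ z := by
  rw [thetaDiff, thetaDiff, theta_add_period hm,
    show -(k + 2 * m * n) = -k + 2 * m * (-n : ℤ) by push_cast; ring, theta_add_period hm]

lemma thetaDiff_neg (k m τ z : ℂ) : thetaDiff (-k) m τ z = -thetaDiff k m τ z := by
  rw [thetaDiff, thetaDiff, neg_neg, neg_sub]

lemma thetaDiff_zero (m τ z : ℂ) : thetaDiff 0 m τ z = 0 := by
  rw [thetaDiff, neg_zero, sub_self]

lemma thetaDiff_self {m : ℂ} (hm : m ≠ 0) (τ z : ℂ) : thetaDiff m m τ z = 0 := by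
  have h := theta_add_period hm (-m) τ z 1
  rw [show -m + 2 * m * ((1 : ℤ) : ℂ) = m by push_cast; ring] at h
  rw [thetaDiff, h, sub_self]

/-! ### Rearrangement of the finite sums -/

/-- An odd number below `2N` is some `k < N`, or `2N - k` with such a `k`, or `N` itself; the last
is discarded by hypothesis. -/
lemma sum_odd_eq (N : ℕ) (χ : ℕ → ℂ) (h : Odd N → χ N = 0) :
    ∑ i ∈ Finset.range N, χ (2 * i + 1) = ∑ k ∈ (Finset.range N).filter Odd, χ k
      + ∑ k ∈ (Finset.range N).filter Odd, χ (2 * N - k) := by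
  have h1 : ∑ i ∈ Finset.range N, χ (2 * i + 1) = ∑ n ∈ (Finset.range (2 * N)).filter Odd, χ n := by
    refine Finset.sum_nbij' (fun i => 2 * i + 1) (fun n => n / 2) ?_ ?_ ?_ ?_ ?_
    · intro i hi
      simp only [Finset.mem_filter, Finset.mem_range] at *
      exact ⟨by omega, by simp⟩
    · intro n hn
      simp only [Finset.mem_filter, Finset.mem_range] at *
      omega
    · intro i _; omega
    · intro n hn
      simp only [Finset.mem_filter, Finset.mem_range] at hn
      exact Nat.two_mul_div_two_add_one_of_odd hn.2
    · intro i _; rfl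
  have h2 : ∑ n ∈ ((Finset.range (2 * N)).filter Odd).filter (fun n => ¬ n < N), χ n
      = ∑ k ∈ (Finset.range (N + 1)).filter Odd, χ (2 * N - k) := by
    refine Finset.sum_nbij' (fun n => 2 * N - n) (fun n => 2 * N - n) ?_ ?_ ?_ ?_ ?_
    · intro n hn
      simp only [Finset.mem_filter, Finset.mem_range] at *
      refine ⟨by omega, ?_⟩
      have h3 := Nat.odd_iff.mp hn.1.2
      exact Nat.odd_iff.mpr (by omega)
    · intro n hn
      simp only [Finset.mem_filter, Finset.mem_range] at *
      have h3 := Nat.odd_iff.mp hn.2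
      exact ⟨⟨by omega, Nat.odd_iff.mpr (by omega)⟩, by omega⟩
    · intro n hn
      simp only [Finset.mem_filter, Finset.mem_range] at hn; omega
    · intro n hn
      simp only [Finset.mem_filter, Finset.mem_range] at hn; omega
    · intro n hn
      simp only [Finset.mem_filter, Finset.mem_range] at hn
      congr 1; omega
  have h3 : ((Finset.range (2 * N)).filter Odd).filter (fun n => n < N)
      = (Finset.range N).filter Odd := by
    ext n; simp only [Finset.mem_filter, Finset.mem_range]
    constructor
    · rintro ⟨⟨_, b⟩, c⟩; exact ⟨c, b⟩
    · rintro ⟨a, b⟩; exact ⟨⟨by omega, b⟩, a⟩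
  rw [h1, ← Finset.sum_filter_add_sum_filter_not _ (fun n => n < N), h2, h3]
  congr 1
  rw [Finset.sum_filter, Finset.sum_range_succ, ← Finset.sum_filter]
  split_ifs with hN
  · rw [show 2 * N - N = N by omega, h hN, add_zero]
  · rw [add_zero]

lemma sum_range_mul_eq (N j : ℕ) (χ : ℕ → ℂ) :
    ∑ b ∈ Finset.range (N * j), χ b
      = ∑ r ∈ Finset.range j, ∑ i ∈ Finset.range N, χ (N * r + i) := by
  induction j with
  | zero => simp
  | succ j ih => rw [Nat.mul_succ, Finset.sum_range_add, ih, Finset.sum_range_succ]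

/-- The summand of `halfTerm` as a function of an odd integer. -/
noncomputable def oddTerm (N : ℕ) (τ z₁ z₂ : ℂ) (j n : ℕ) : ℂ :=
  (-1) ^ j * ee (τ * ((j : ℂ) ^ 2 + n * j - (n : ℂ) ^ 2 / (4 * N)))
    * expSum ((Real.pi : ℂ) * I * n * (z₁ - z₂)) * thetaDiff n N τ (z₁ + z₂)

/-- The odd numbers below `2Nj` are cut into blocks of length `2N`. Periodicity and oddness of `D`
in its index reduce each to `k < N`, and `D_{N,N} = 0` removes the middle of a block. -/
lemma halfTerm_eq_sum {N : ℕ} (hN : 0 < N) (τ z₁ z₂ : ℂ) (j : ℕ) :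
    halfTerm N τ z₁ z₂ j = -∑ b ∈ Finset.range (N * j), oddTerm N τ z₁ z₂ j (2 * b + 1) := by
  have hN' : (N : ℂ) ≠ 0 := by exact_mod_cast hN.ne'
  have hblock : ∀ r, ∑ i ∈ Finset.range N, oddTerm N τ z₁ z₂ j (2 * (N * r + i) + 1)
      = ∑ k ∈ (Finset.range N).filter Odd, oddTerm N τ z₁ z₂ j (2 * N * r + k)
      + ∑ k ∈ (Finset.range N).filter Odd, oddTerm N τ z₁ z₂ j (2 * N * r + (2 * N - k)) := fun r => by
    rw [← sum_odd_eq N (fun n => oddTerm N τ z₁ z₂ j (2 * N * r + n))]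
    · refine Finset.sum_congr rfl fun i _ => ?_
      congr 1; ring
    · intro _
      simp only [oddTerm]
      have := thetaDiff_add_period hN' N τ (z₁ + z₂) r
      rw [thetaDiff_self hN'] at this
      rw [show ((2 * N * r + N : ℕ) : ℂ) = N + 2 * N * (r : ℤ) by push_cast; ring, this, mul_zero]
  rw [sum_range_mul_eq N j (fun b => oddTerm N τ z₁ z₂ j (2 * b + 1)),
    Finset.sum_congr rfl (fun r _ => hblock r), Finset.sum_add_distrib, neg_add, add_comm, halfTerm,
    sub_eq_add_neg]
  congr 1
  · rw [← Finset.sum_neg_distrib]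
    -- The upper half of block `r - 1` consists of the numbers `2Nr - k`, which is why `r` starts at
    -- `1`; `D_{-k} = -D_k` accounts for the sign.
    refine Finset.sum_nbij' (fun r => r - 1) (fun r => r + 1) ?_ ?_ ?_ ?_ ?_
    · intro r hr; simp only [Finset.mem_Icc, Finset.mem_range] at *; omega
    · intro r hr; simp only [Finset.mem_Icc, Finset.mem_range] at *; omega
    · intro r hr; simp only [Finset.mem_Icc] at hr; omega
    · intro r _; omega
    · intro r hr
      obtain ⟨s, rfl⟩ : ∃ s, r = s + 1 := ⟨r - 1, by simp only [Finset.mem_Icc] at hr; omega⟩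
      rw [Nat.add_sub_cancel, ← Finset.sum_neg_distrib]
      refine Finset.sum_congr rfl fun k hk => ?_
      have hk' : k < N := by simpa using (Finset.mem_filter.mp hk).1
      have hc : ((2 * N * s + (2 * N - k) : ℕ) : ℂ) = 2 * N * (s + 1 : ℕ) - k := by
        rw [Nat.cast_add, Nat.cast_sub (by omega)]; push_cast; ring
      rw [oddTerm, hc, show 2 * (N : ℂ) * (s + 1 : ℕ) - k = -k + 2 * N * ((s + 1 : ℕ) : ℤ) by
        push_cast; ring, thetaDiff_add_period hN', thetaDiff_neg, qPow_eq,
        show -(k : ℂ) + 2 * N * ((s + 1 : ℕ) : ℤ) = 2 * N * (s + 1 : ℕ) - k by push_cast; ring,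
        mul_neg, neg_neg]
      congr 4
      field_simp
      ring
  · congr 1
    refine Finset.sum_congr rfl fun r _ => Finset.sum_congr rfl fun k _ => ?_
    have hc : ((2 * N * r + k : ℕ) : ℂ) = 2 * N * r + k := by push_cast; ring
    rw [oddTerm, hc, show 2 * (N : ℂ) * r + k = k + 2 * N * (r : ℤ) by
        push_cast; ring, thetaDiff_add_period hN', qPow_eq,
        show (k : ℂ) + 2 * N * (r : ℤ) = 2 * N * r + k by push_cast; ring]
    congr 4
    field_simp
    ring

lemma expSum_eq (w d : ℂ) : expSum ((Real.pi : ℂ) * I * w * d) = ee (w / 2 * d) + ee (-(w / 2 * d)) := by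
  rw [expSum, ee, ee]; congr 2 <;> ring

/-- For `J = j ≥ 0` the weight is `-1` on `0 ≤ b < Nj` and `0` elsewhere. -/
lemma tsum_coreCoeff_nat {N : ℕ} (τ d : ℂ) (D : ℂ → ℂ) (j : ℕ) :
    ∑' b : ℤ, coreCoeff N τ d j b * D (2 * b + 1)
      = -∑ b ∈ Finset.range (N * j), (-1) ^ j *
        ee (τ * ((j : ℂ) ^ 2 + (2 * b + 1) * j - (2 * b + 1) ^ 2 / (4 * N)) + (b + 1 / 2) * d)
          * D (2 * b + 1) := by
  have h := sum_range_add_int (fun b : ℤ => (-1) ^ j *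
        ee (τ * ((j : ℂ) ^ 2 + (2 * b + 1) * j - (2 * b + 1) ^ 2 / (4 * N)) + (b + 1 / 2) * d)
          * D (2 * b + 1)) 0 (N * j)
  simp only [add_zero, zero_add, Int.cast_natCast] at h
  rw [h, tsum_eq_sum (s := Finset.Ico (0 : ℤ) ((N * j : ℕ) : ℤ)), ← Finset.sum_neg_distrib]
  · refine Finset.sum_congr rfl fun b hb => ?_
    rw [Finset.mem_Ico] at hb
    rw [coreCoeff, below, if_neg (by omega), below, if_pos (by push_cast at hb; exact hb.2)]
    simp only [zpow_natCast, Int.cast_natCast]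
    ring
  · intro b hb
    rw [Finset.mem_Ico] at hb
    have : below b 0 - below b (N * j) = 0 := by
      have h0 : (0 : ℤ) ≤ N * j := by positivity
      push_cast at hb
      unfold below; split_ifs <;> first | omega | simp
    rw [coreCoeff, this, zero_mul, zero_mul]

/-- Reflection turns the part with `-j` into the part with `j` and `-d`; the exponentials in `d` and
`-d` add up to `expSum`. -/
lemma tsum_coreCoeff_pair {N : ℕ} (hN : 0 < N) (τ z₁ z₂ : ℂ) (j : ℕ) :
    ∑' b : ℤ, coreCoeff N τ (z₁ - z₂) j b * thetaDiff (2 * b + 1) N τ (z₁ + z₂)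
      + ∑' b : ℤ, coreCoeff N τ (z₁ - z₂) (-j) b * thetaDiff (2 * b + 1) N τ (z₁ + z₂)
      = halfTerm N τ z₁ z₂ j := by
  have h2 : ∑' b : ℤ, coreCoeff N τ (z₁ - z₂) (-j) b * thetaDiff (2 * b + 1) N τ (z₁ + z₂)
      = ∑' b : ℤ, coreCoeff N τ (-(z₁ - z₂)) j b * thetaDiff (2 * b + 1) N τ (z₁ + z₂) := by
    rw [← (Equiv.subLeft (-1 : ℤ)).tsum_eq]
    refine tsum_congr fun b => ?_
    have h := coreCoeff_reflect N τ (-(z₁ - z₂)) j b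
    rw [neg_neg] at h
    rw [Equiv.subLeft_apply, h, show (2 * ((-1 - b : ℤ) : ℂ) + 1) = -(2 * b + 1) by push_cast; ring,
      thetaDiff_neg]
    ring
  rw [h2, tsum_coreCoeff_nat τ _ (fun k => thetaDiff k N τ (z₁ + z₂)),
    tsum_coreCoeff_nat τ _ (fun k => thetaDiff k N τ (z₁ + z₂)), halfTerm_eq_sum hN, ← neg_add,
    ← Finset.sum_add_distrib]
  congr 1
  refine Finset.sum_congr rfl fun b _ => ?_
  rw [oddTerm, expSum_eq]
  simp only [Nat.cast_add, Nat.cast_mul, Nat.cast_ofNat, Nat.cast_one]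
  rw [show (2 * (b : ℂ) + 1) / 2 * (z₁ - z₂) = (b + 1 / 2) * (z₁ - z₂) by ring,
    mul_neg, ee_add, ee_add]
  ring

lemma hasSum_halfTerm {N : ℕ} (hN : 0 < N) {τ : ℂ} (hτ : 0 < τ.im) (z₁ z₂ : ℂ) :
    HasSum (halfTerm N τ z₁ z₂)
      ((∑' p : ℤ × ℤ × ℤ, (below p.2.2 p.2.1 - below p.2.2 (N * p.1))
        * coreTerm N τ (z₁ - z₂) (z₁ + z₂) p.1 p.2.1 p.2.2)
      + ∑' p : ℤ × ℤ × ℤ, (below p.2.2 p.2.1 - below p.2.2 (N * p.1))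
        * coreTerm N τ (z₂ - z₁) (z₂ + z₁) p.1 p.2.1 p.2.2) := by
  have h := hasSum_symmetrized hN hτ z₁ z₂
  have h1 := h.prod_fiberwise fun J => (h.summable.prod_factor J).hasSum
  -- Pairing `j` with `-j` counts `J = 0` twice; this is harmless because that term has an empty
  -- range of `b`.
  have h2 := h1.nat_add_neg
  have h0 : ∑' b : ℤ, coreCoeff N τ (z₁ - z₂) 0 b * thetaDiff (2 * b + 1) N τ (z₁ + z₂) = 0 := by
    have := tsum_coreCoeff_nat (N := N) τ (z₁ - z₂) (fun k => thetaDiff k N τ (z₁ + z₂)) 0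
    simpa using this
  rw [h0, add_zero] at h2
  exact h2.congr_fun fun j => (tsum_coreCoeff_pair hN τ z₁ z₂ j).symm

/-! ### The explicit formula in the half-integral case -/

lemma thetaMinus_zero_neg (N : ℕ) (τ z : ℂ) :
    thetaMinus 0 (N + 1) τ (-z) = thetaMinus 0 (N + 1) τ z := by
  have hN1 : (N : ℂ) + 1 ≠ 0 := by exact_mod_cast N.succ_ne_zero
  have h1 : -z = -((N + 1) * z) / (N + 1) := by field_simp
  have h2 : z = ((N + 1) * z) / (N + 1) := by field_simp
  rw [h1, thetaMinus_zero_eq, ← (Equiv.neg ℤ).tsum_eq]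
  conv_rhs => rw [h2, thetaMinus_zero_eq]
  refine tsum_congr fun j => ?_
  rw [Equiv.neg_apply, neg_one_zpow_neg]
  congr 2; push_cast; ring

lemma appell_eq_div {τ z : ℂ} (hτ : 0 < τ.im) (hz : OffLattice (2 * τ) (2 * z)) :
    appell τ z = -I * ModularForm.eta (2 * τ) ^ 3 / vartheta11 (2 * τ) (2 * z) := by
  rw [eq_div_iff (vartheta11_ne_zero (by simpa using hτ) hz), appell_mul_vartheta11 hτ hz]

lemma halfRegular_offLattice {N : ℕ} {τ z₁ z₂ : ℂ} (hτ : 0 < τ.im) (h : HalfRegular N τ z₁ z₂) :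
    OffLattice (2 * τ) (2 * z₁) ∧ OffLattice (2 * τ) (2 * z₂) :=
  ⟨(vartheta11_ne_zero_iff (by simpa using hτ) _).mp h.2.1,
    (vartheta11_ne_zero_iff (by simpa using hτ) _).mp h.2.2⟩

lemma intRegular_offLattice {N : ℕ} {τ z₁ z₂ : ℂ} (hτ : 0 < τ.im) (h : IntRegular N τ z₁ z₂) :
    OffLattice (2 * τ) (2 * z₁) ∧ OffLattice (2 * τ) (2 * z₂) :=
  ⟨(vartheta11_ne_zero_iff (by simpa using hτ) _).mp h.2.1,
    (vartheta11_ne_zero_iff (by simpa using hτ) _).mp h.2.2⟩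

/-- Since `θ^{(-)}_{0,N+1}` is even, one and the same factor `halfTheta` works for both orders of
`z₁, z₂`. -/
lemma halfTheta_mul_thetaAppell {N : ℕ} (hN : 0 < N) {τ z₁ z₂ : ℂ} (hτ : 0 < τ.im)
    (hz₁ : OffLattice (2 * τ) (2 * z₁)) (hz₂ : OffLattice (2 * τ) (2 * z₂)) :
    halfTheta N τ z₁ z₂ * (thetaAppell N τ z₁ z₂ + thetaAppell N τ z₂ z₁)
      = -I * ModularForm.eta (2 * τ) ^ 3
      * (thetaMinus 0 (N + 1) τ ((z₁ - z₂) / (N + 1) + z₁ + z₂) / vartheta11 (2 * τ) (2 * z₁)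
        + thetaMinus 0 (N + 1) τ ((z₁ - z₂) / (N + 1) - z₁ - z₂) / vartheta11 (2 * τ) (2 * z₂))
    + ∑' j : ℕ, halfTerm N τ z₁ z₂ j := by
  have h1 := theta_mul_thetaAppell hN hτ hz₁ (z₂ := z₂)
  have h2 := theta_mul_thetaAppell hN hτ hz₂ (z₂ := z₁)
  rw [show (N : ℂ) * (z₂ - z₁) / (N + 1) = -(N * (z₁ - z₂) / (N + 1)) by ring,
    show (z₂ - z₁) / ((N : ℂ) + 1) + z₂ + z₁ = -((z₁ - z₂) / (N + 1) - z₁ - z₂) by ring,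
    thetaMinus_zero_neg, thetaMinus_zero_neg] at h2
  rw [(hasSum_halfTerm hN hτ z₁ z₂).tsum_eq, halfTheta, mul_add, h1, h2, appell_eq_div hτ hz₁,
    appell_eq_div hτ hz₂]
  ring

lemma halfFormula_eq {N : ℕ} (hN : 0 < N) {τ z₁ z₂ : ℂ} (hτ : 0 < τ.im)
    (h : HalfRegular N τ z₁ z₂) :
    halfFormula N τ z₁ z₂ = thetaAppell N τ z₁ z₂ + thetaAppell N τ z₂ z₁ := by
  obtain ⟨h1, h2⟩ := halfRegular_offLattice hτ h
  rw [halfFormula, ← halfTheta_mul_thetaAppell hN hτ h1 h2, mul_div_cancel_left₀ _ h.1]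

/-! ### Elementary properties of the mock theta functions -/

lemma phi1Term_eq (m s τ z₁ z₂ : ℂ) (j : ℤ) :
    phi1Term m s τ z₁ z₂ j
      = ee (m * j * (z₁ + z₂) + s * z₁ + τ * (m * (j : ℂ) ^ 2 + s * j)) / (1 - ee (z₁ + j * τ)) := by
  rw [phi1Term, qPow_eq, qPow_eq, show 2 * (Real.pi : ℂ) * I * m * j * (z₁ + z₂)
    + 2 * (Real.pi : ℂ) * I * s * z₁ = 2 * (Real.pi : ℂ) * I * (m * j * (z₁ + z₂) + s * z₁) by ring]
  change ee _ * _ / (1 - ee _ * _) = _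
  rw [← ee_add, ← ee_add, mul_comm τ (j : ℂ)]

lemma phi2Term_eq_phi1Term (m s τ z₁ z₂ : ℂ) (j : ℤ) :
    phi2Term m s τ z₁ z₂ j = phi1Term m s τ (-z₂) (-z₁) j := by
  rw [phi2Term, phi1Term]
  congr 3
  · ring
  · congr 2; ring

lemma offLattice_neg {τ z : ℂ} (h : OffLattice τ z) : OffLattice τ (-z) := fun a b hz =>
  h (-a) (-b) (by push_cast; linear_combination -hz)

lemma summable_phi1Term {N : ℕ} (hN : 0 < N) (s : ℂ) {τ z₁ : ℂ} (hτ : 0 < τ.im)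
    (hz : OffLattice τ z₁) (z₂ : ℂ) : Summable (phi1Term (N / 2) s τ z₁ z₂) := by
  obtain ⟨C, hC, h⟩ := exists_norm_inv_one_sub_ee_le hτ hz
  have hN1 : (0 : ℝ) < N / 2 := by positivity
  refine Summable.of_norm_bounded
    ((summable_ee_quadratic hτ hN1 (N / 2 * (z₁ + z₂) + s * τ) (s * z₁)).norm.mul_right C) fun j => ?_
  rw [phi1Term_eq, div_eq_mul_inv, norm_mul]
  refine mul_le_mul (le_of_eq ?_) (h j) (norm_nonneg _) (norm_nonneg _)
  congr 2; push_cast; ring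

lemma summable_phi2Term {N : ℕ} (hN : 0 < N) (s : ℂ) {τ z₂ : ℂ} (hτ : 0 < τ.im)
    (hz : OffLattice τ z₂) (z₁ : ℂ) : Summable (phi2Term (N / 2) s τ z₁ z₂) := by
  rw [show phi2Term (N / 2) s τ z₁ z₂ = phi1Term (N / 2) s τ (-z₂) (-z₁) from
    funext fun j => phi2Term_eq_phi1Term _ _ _ _ _ j]
  exact summable_phi1Term hN s hτ (offLattice_neg hz) _

lemma Phi_eq (m s τ z₁ z₂ t : ℂ) :
    Phi m s τ z₁ z₂ t = ee (-(m * t)) *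
      (∑' j : ℤ, phi1Term m s τ z₁ z₂ j - ∑' j : ℤ, phi2Term m s τ z₁ z₂ j) := by
  have : cexp (-(2 * (Real.pi : ℂ) * I * m * t)) = ee (-(m * t)) := by
    rw [ee]; congr 1; ring
  rw [Phi, Phi1, Phi2, this, mul_sub]

lemma Phi_eq_mul_Phi_zero (m s τ z₁ z₂ t : ℂ) :
    Phi m s τ z₁ z₂ t = ee (-(m * t)) * Phi m s τ z₁ z₂ 0 := by
  rw [Phi_eq, Phi_eq m s τ z₁ z₂ 0, mul_zero, neg_zero, ee_zero, one_mul]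

lemma Phi_zero_eq (m s τ z₁ z₂ : ℂ) :
    Phi m s τ z₁ z₂ 0 = ∑' j : ℤ, phi1Term m s τ z₁ z₂ j - ∑' j : ℤ, phi2Term m s τ z₁ z₂ j := by
  rw [Phi_eq, mul_zero, neg_zero, ee_zero, one_mul]

/-- After `j ↦ -j` the second series carries `cosec` at a negated argument, and `cosec` is odd,
which turns the difference into a sum. -/
lemma Phi_half_eq (N : ℕ) (τ z₁ z₂ : ℂ) :
    Phi (N / 2) (1 / 2) (2 * τ) (2 * z₁) (2 * z₂) 0
      = thetaAppell N τ z₁ z₂ + thetaAppell N τ z₂ z₁ := by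
  rw [Phi_zero_eq, sub_eq_add_neg, thetaAppell, thetaAppell, ← tsum_neg]
  congr 1
  · refine tsum_congr fun j => ?_
    rw [phi1Term_eq, cosec, ← mul_div_assoc, ← ee_add]
    congr 1
    · congr 1; ring
    · congr 2; ring
  · rw [← (Equiv.neg ℤ).tsum_eq]
    refine tsum_congr fun j => ?_
    rw [Equiv.neg_apply, phi2Term_eq_phi1Term, phi1Term_eq, cosec]
    have h : ee (-(2 * z₂) + (-j : ℤ) * (2 * τ)) = (ee (2 * (z₂ + j * τ)))⁻¹ := by
      rw [← ee_neg]; congr 1; push_cast; ring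
    rw [h]
    have h2 : ee (↑N / 2 * ((-j : ℤ) : ℂ) * (-(2 * z₂) + -(2 * z₁)) + 1 / 2 * -(2 * z₂)
        + 2 * τ * (↑N / 2 * ((-j : ℤ) : ℂ) ^ 2 + 1 / 2 * ((-j : ℤ) : ℂ)))
        = ee (τ * N * (j : ℂ) ^ 2 + N * j * (z₂ + z₁)) * ee (z₂ + j * τ)
          * (ee (2 * (z₂ + j * τ)))⁻¹ := by
      rw [← ee_neg, ← ee_add, ← ee_add]; congr 1; push_cast; ring
    rw [h2]
    set E := ee (2 * (z₂ + j * τ))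
    have hE : E ≠ 0 := ee_ne_zero _
    -- At a pole both fractions are `0` by the convention for division by zero, so no condition on
    -- `z₂` is needed.
    by_cases h1 : 1 - E = 0
    · have : E = 1 := (sub_eq_zero.mp h1).symm
      simp [this]
    · have h3 : 1 - E⁻¹ ≠ 0 := by
        intro h4
        apply h1
        have : E⁻¹ = 1 := (sub_eq_zero.mp h4).symm
        rw [inv_eq_one.mp this, sub_self]
      have h5 : E - 1 ≠ 0 := fun h => h1 (by linear_combination -h)
      field_simp
      ring

lemma halfFormula_eq_Phi {N : ℕ} (hN : 0 < N) {τ z₁ z₂ : ℂ} (hτ : 0 < τ.im)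
    (h : HalfRegular N τ z₁ z₂) :
    halfFormula N τ z₁ z₂ = Phi (N / 2) (1 / 2) (2 * τ) (2 * z₁) (2 * z₂) 0 := by
  rw [halfFormula_eq hN hτ h, Phi_half_eq]

/-! ### Shifting `s` by an integer -/

lemma phi1Term_sub_succ (m s : ℂ) {τ z₁ : ℂ} (hz : OffLattice τ z₁) (z₂ : ℂ) (j : ℤ) :
    phi1Term m s τ z₁ z₂ j - phi1Term m (s + 1) τ z₁ z₂ j
      = ee (m * j * (z₁ + z₂) + s * z₁ + τ * (m * (j : ℂ) ^ 2 + s * j)) := by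
  have h := ee_add_int_mul_ne_one hz j
  rw [phi1Term_eq, phi1Term_eq, show m * j * (z₁ + z₂) + (s + 1) * z₁
    + τ * (m * (j : ℂ) ^ 2 + (s + 1) * j) = (m * j * (z₁ + z₂) + s * z₁
    + τ * (m * (j : ℂ) ^ 2 + s * j)) + (z₁ + j * τ) by ring, ee_add _ (z₁ + j * τ)]
  field_simp

lemma ee_mul_theta {m : ℂ} (hm : m ≠ 0) (s τ d u : ℂ) :
    ee (s * d / 2 - τ * (s ^ 2 / (4 * m))) * theta s m τ u
      = ∑' j : ℤ, ee (m * j * u + s * ((u + d) / 2) + τ * (m * (j : ℂ) ^ 2 + s * j)) := by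
  rw [theta_eq hm, ← mul_assoc, ← ee_add, ← tsum_mul_left]
  refine tsum_congr fun j => ?_
  rw [← ee_add]
  congr 1
  field_simp
  ring

lemma theta_neg_char {m : ℂ} (hm : m ≠ 0) (k τ z : ℂ) : theta (-k) m τ z = theta k m τ (-z) := by
  rw [theta_eq hm, theta_eq hm, ← (Equiv.neg ℤ).tsum_eq]
  congr 1
  · congr 1; ring
  · refine tsum_congr fun j => ?_
    rw [Equiv.neg_apply]; congr 1; push_cast; ring

/-- Since `1/(1-x) - x/(1-x) = 1`, the denominators disappear and both series become theta series.
-/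
lemma Phi_sub_succ {N : ℕ} (hN : 0 < N) (s : ℂ) {τ z₁ z₂ : ℂ} (hτ : 0 < τ.im)
    (hz₁ : OffLattice τ z₁) (hz₂ : OffLattice τ z₂) :
    Phi (N / 2) s τ z₁ z₂ 0 - Phi (N / 2) (s + 1) τ z₁ z₂ 0 = shiftTerm N s τ z₁ z₂ := by
  have hN' : (N : ℂ) / 2 ≠ 0 := by
    have : (N : ℂ) ≠ 0 := by exact_mod_cast hN.ne'
    simpa using this
  have h1 := ((summable_phi1Term hN s hτ hz₁ z₂).hasSum.sub
    (summable_phi1Term hN (s + 1) hτ hz₁ z₂).hasSum).tsum_eq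
  have h2 := ((summable_phi2Term hN s hτ hz₂ z₁).hasSum.sub
    (summable_phi2Term hN (s + 1) hτ hz₂ z₁).hasSum).tsum_eq
  simp only [phi2Term_eq_phi1Term] at h2
  simp only [phi1Term_sub_succ _ _ hz₁] at h1
  simp only [phi1Term_sub_succ _ _ (offLattice_neg hz₂)] at h2
  have e1 := ee_mul_theta hN' s τ (z₁ - z₂) (z₁ + z₂)
  have e2 := ee_mul_theta hN' s τ (z₁ - z₂) (-z₂ + -z₁)
  rw [show (z₁ + z₂ + (z₁ - z₂)) / 2 = z₁ by ring, h1] at e1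
  rw [show (-z₂ + -z₁ + (z₁ - z₂)) / 2 = -z₂ by ring, h2, show -z₂ + -z₁ = -(z₁ + z₂) by ring] at e2
  rw [Phi_zero_eq, Phi_zero_eq, shiftTerm, thetaDiff, theta_neg_char hN', qPow_eq,
    show (Real.pi : ℂ) * I * s * (z₁ - z₂) = 2 * Real.pi * I * (s * (z₁ - z₂) / 2) by ring]
  simp only [phi2Term_eq_phi1Term]
  change _ = ee _ * _ * _
  rw [← ee_add, show s * (z₁ - z₂) / 2 + τ * -(s ^ 2 / (2 * N))
    = s * (z₁ - z₂) / 2 - τ * (s ^ 2 / (4 * (N / 2))) by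
      field_simp; ring, mul_sub, e1, e2]
  ring

lemma eq_sub_sum_Ico_add_sum_Ico {f σ : ℤ → ℂ} (h : ∀ k, f k - f (k + 1) = σ k) (n : ℤ) :
    f n = f 0 - ∑ k ∈ Finset.Ico 0 n, σ k + ∑ k ∈ Finset.Ico n 0, σ k := by
  rcases le_total 0 n with hn | hn
  · rw [Finset.Ico_eq_empty (a := n) (by omega), Finset.sum_empty, add_zero]
    induction n, hn using Int.leInduction with
    | base => simp
    | succ k hk ih =>
      rw [← Finset.insert_Ico_right_eq_Ico_add_one hk, Finset.sum_insert (by simp), ← h k]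
      linear_combination ih
  · rw [Finset.Ico_eq_empty (b := n) (by omega), Finset.sum_empty, sub_zero]
    induction n, hn using Int.leInductionDown with
    | base => simp
    | pred k hk ih =>
      have h1 := h (k - 1)
      rw [sub_add_cancel] at h1
      have h2 : Finset.Ico (k - 1) 0 = insert (k - 1) (Finset.Ico k 0) := by
        ext x; simp only [Finset.mem_Ico, Finset.mem_insert]; omega
      rw [h2, Finset.sum_insert (by simp), ← h1]
      linear_combination ih

lemma Phi_add_int {N : ℕ} (hN : 0 < N) (s : ℂ) (n : ℤ) {τ z₁ z₂ : ℂ} (hτ : 0 < τ.im)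
    (hz₁ : OffLattice τ z₁) (hz₂ : OffLattice τ z₂) :
    Phi (N / 2) (s + n) τ z₁ z₂ 0 = Phi (N / 2) s τ z₁ z₂ 0
      - ∑ k ∈ Finset.Ico 0 n, shiftTerm N (s + k) τ z₁ z₂
      + ∑ k ∈ Finset.Ico n 0, shiftTerm N (s + k) τ z₁ z₂ := by
  have := eq_sub_sum_Ico_add_sum_Ico (f := fun n : ℤ => Phi (N / 2) (s + n) τ z₁ z₂ 0)
    (σ := fun n : ℤ => shiftTerm N (s + n) τ z₁ z₂) (fun k => by
      have h := Phi_sub_succ hN (s + k) hτ hz₁ hz₂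
      push_cast
      rw [← add_assoc]; exact h) n
  simpa using this

/-! ### Duplication -/

lemma phi1Term_duplication (m : ℂ) {τ z₁ : ℂ} (hz : OffLattice (2 * τ) (2 * z₁)) (z₂ : ℂ) (j : ℤ) :
    phi1Term (2 * m) 0 τ z₁ z₂ j
      = phi1Term m 0 (2 * τ) (2 * z₁) (2 * z₂) j + phi1Term m (1 / 2) (2 * τ) (2 * z₁) (2 * z₂) j := by
  have h := ee_add_int_mul_ne_one hz j
  rw [phi1Term_eq, phi1Term_eq, phi1Term_eq, ← add_div]
  have e1 : m * j * (2 * z₁ + 2 * z₂) + 0 * (2 * z₁) + 2 * τ * (m * (j : ℂ) ^ 2 + 0 * j)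
      = 2 * m * j * (z₁ + z₂) + 0 * z₁ + τ * (2 * m * (j : ℂ) ^ 2 + 0 * j) := by ring
  have e2 : m * j * (2 * z₁ + 2 * z₂) + 1 / 2 * (2 * z₁) + 2 * τ * (m * (j : ℂ) ^ 2 + 1 / 2 * j)
      = (2 * m * j * (z₁ + z₂) + 0 * z₁ + τ * (2 * m * (j : ℂ) ^ 2 + 0 * j)) + (z₁ + j * τ) := by ring
  have e3 : ee (2 * z₁ + j * (2 * τ)) = ee (z₁ + j * τ) * ee (z₁ + j * τ) := by
    rw [← ee_add]; congr 1; ring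
  rw [e1, e2, ee_add _ (z₁ + j * τ), e3]
  rw [e3] at h
  have h1 : 1 - ee (z₁ + j * τ) ≠ 0 := fun h0 => h (by linear_combination (1 + ee (z₁ + j * τ)) * h0)
  rw [div_eq_div_iff h1 h]
  ring

lemma Phi_duplication {N : ℕ} (hN : 0 < N) {τ z₁ z₂ : ℂ} (hτ : 0 < τ.im)
    (hz₁ : OffLattice (2 * τ) (2 * z₁)) (hz₂ : OffLattice (2 * τ) (2 * z₂)) :
    Phi N 0 τ z₁ z₂ 0 = Phi (N / 2) 0 (2 * τ) (2 * z₁) (2 * z₂) 0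
      + Phi (N / 2) (1 / 2) (2 * τ) (2 * z₁) (2 * z₂) 0 := by
  have hτ' : 0 < (2 * τ).im := by simpa using hτ
  have h1 := ((summable_phi1Term hN 0 hτ' hz₁ (2 * z₂)).hasSum.add
    (summable_phi1Term hN (1 / 2) hτ' hz₁ (2 * z₂)).hasSum).tsum_eq
  have h2 := ((summable_phi2Term hN 0 hτ' hz₂ (2 * z₁)).hasSum.add
    (summable_phi2Term hN (1 / 2) hτ' hz₂ (2 * z₁)).hasSum).tsum_eq
  simp only [phi2Term_eq_phi1Term, ← mul_neg] at h2
  simp only [← phi1Term_duplication _ hz₁] at h1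
  have hz₂' : OffLattice (2 * τ) (2 * -z₂) := by rw [mul_neg]; exact offLattice_neg hz₂
  simp only [← phi1Term_duplication _ hz₂'] at h2
  rw [Phi_zero_eq, Phi_zero_eq, Phi_zero_eq]
  simp only [phi2Term_eq_phi1Term, ← mul_neg]
  rw [mul_div_cancel₀ _ (two_ne_zero' ℂ)] at h1 h2
  rw [h1, h2]
  ring

/-! ### The explicit formula in the integral case -/

/-- A change of variables, with the index of the second series moved by one. For odd `N` the left
side has integral `s`, so it links the half-integral case to the integral one. -/
lemma Phi_translate (N : ℕ) (τ z₁ z₂ : ℂ) :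
    Phi (N / 2) ((N + 1) / 2) (2 * τ) (2 * z₁) (2 * z₂) 0
      = ee (N * z₁) * Phi (N / 2) (1 / 2) (2 * τ) (2 * z₁) (2 * (z₂ + τ)) 0 := by
  rw [Phi_zero_eq, Phi_zero_eq, mul_sub, ← tsum_mul_left, ← tsum_mul_left]
  congr 1
  · refine tsum_congr fun j => ?_
    rw [phi1Term_eq, phi1Term_eq, ← mul_div_assoc, ← ee_add]
    congr 2; ring
  · rw [← (Equiv.addRight (1 : ℤ)).tsum_eq (fun j => ee (N * z₁) *
      phi2Term (N / 2) (1 / 2) (2 * τ) (2 * z₁) (2 * (z₂ + τ)) j)]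
    refine tsum_congr fun j => ?_
    rw [phi2Term_eq_phi1Term, phi2Term_eq_phi1Term, phi1Term_eq, phi1Term_eq, ← mul_div_assoc,
      ← ee_add, Equiv.coe_addRight]
    congr 1
    · congr 1; push_cast; ring
    · congr 2; push_cast; ring

lemma theta_add_tau {m : ℂ} (hm : m ≠ 0) (k τ z : ℂ) :
    theta k m τ (z + τ) = ee (-(m * z / 2) - m * τ / 4) * theta (k + m) m τ z := by
  rw [theta_eq hm, theta_eq hm, ← mul_assoc, ← ee_add]
  congr 1
  · congr 1; field_simp; ring
  · refine tsum_congr fun j => ?_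
    congr 1; ring

lemma thetaDiff_add_tau {m : ℂ} (hm : m ≠ 0) (k τ z : ℂ) :
    thetaDiff k m τ (z + τ) = -(ee (-(m * z / 2) - m * τ / 4) * thetaDiff (m - k) m τ z) := by
  have h := theta_add_period hm (k - m) τ z 1
  rw [show k - m + 2 * m * ((1 : ℤ) : ℂ) = k + m by push_cast; ring] at h
  rw [thetaDiff, thetaDiff, theta_add_tau hm, theta_add_tau hm, h,
    show -(m - k) = k - m by ring, show -k + m = m - k by ring]
  ring

/-- For odd `N` the map `k ↦ N - k` exchanges parities; `k = 0` has no partner below `N` and has to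
vanish. -/
lemma sum_even_eq_sum_odd {N : ℕ} (hN : Odd N) {G : ℕ → ℂ} (hG : G 0 = 0) :
    ∑ k ∈ (Finset.range N).filter Even, G k = ∑ k ∈ (Finset.range N).filter Odd, G (N - k) := by
  have hN2 := Nat.odd_iff.mp hN
  have h0 : 0 ∈ (Finset.range N).filter Even := by
    simp only [Finset.mem_filter, Finset.mem_range, Even.zero, and_true]; omega
  rw [← Finset.add_sum_erase _ _ h0, hG, zero_add]
  refine Finset.sum_nbij' (fun k => N - k) (fun k => N - k) ?_ ?_ ?_ ?_ ?_
  · intro k hk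
    simp only [Finset.mem_erase, Finset.mem_filter, Finset.mem_range, Nat.even_iff, Nat.odd_iff] at *
    omega
  · intro k hk
    simp only [Finset.mem_erase, Finset.mem_filter, Finset.mem_range, Nat.even_iff, Nat.odd_iff] at *
    omega
  · intro k hk
    simp only [Finset.mem_erase, Finset.mem_filter, Finset.mem_range] at hk; omega
  · intro k hk
    simp only [Finset.mem_filter, Finset.mem_range] at hk; omega
  · intro k hk
    simp only [Finset.mem_erase, Finset.mem_filter, Finset.mem_range] at hk
    congr 1; omega

/-- Translating `u` by `τ` takes `D_k` to a multiple of `-D_{N-k}`, which explains the even indices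
and the argument `d - τ` in `intTerm`. -/
lemma intTerm_eq {N : ℕ} (hN : Odd N) (τ z₁ z₂ : ℂ) (j : ℕ) :
    intTerm N τ z₁ z₂ j = ee (N * (z₁ + z₂) / 2 + N * τ / 4) * halfTerm N τ z₁ (z₂ + τ) j := by
  have hN' : (N : ℂ) ≠ 0 := by exact_mod_cast hN.pos.ne'
  set c := ee (N * (z₁ + z₂) / 2 + N * τ / 4) with hc
  have hD : ∀ k : ℂ, c * thetaDiff k N τ (z₁ + (z₂ + τ)) = -thetaDiff (N - k) N τ (z₁ + z₂) := by
    intro k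
    rw [← add_assoc, thetaDiff_add_tau hN', mul_neg, ← mul_assoc, hc, ← ee_add]
    rw [show N * (z₁ + z₂) / 2 + N * τ / 4 + (-(N * (z₁ + z₂) / 2) - N * τ / 4) = 0 by ring, ee_zero,
      one_mul]
  have hzero : ∀ a b : ℂ, a * b * thetaDiff ((0 : ℕ) : ℂ) N τ (z₁ + z₂) = 0 := fun a b => by
    rw [Nat.cast_zero, thetaDiff_zero, mul_zero]
  rw [intTerm, halfTerm, mul_sub c, sub_eq_add_neg (c * _), Finset.mul_sum, Finset.mul_sum]
  congr 1
  · rw [← Finset.sum_neg_distrib]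
    refine Finset.sum_congr rfl fun r _ => ?_
    rw [sum_even_eq_sum_odd hN (hzero _ _), Finset.mul_sum, ← Finset.sum_neg_distrib]
    refine Finset.sum_congr rfl fun k hk => ?_
    have hk' : k ≤ N := by
      have := (Finset.mem_filter.mp hk).1
      rw [Finset.mem_range] at this; omega
    rw [mul_left_comm, hD, mul_neg, Nat.cast_sub hk', show z₁ - (z₂ + τ) = z₁ - z₂ - τ by ring]
    congr 4
    · congr 2; ring
    · congr 2; ring
  · rw [← Finset.sum_neg_distrib]
    refine Finset.sum_congr rfl fun r _ => ?_
    rw [sum_even_eq_sum_odd hN (hzero _ _), Finset.mul_sum, ← Finset.sum_neg_distrib]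
    refine Finset.sum_congr rfl fun k hk => ?_
    have hk' : k ≤ N := by
      have := (Finset.mem_filter.mp hk).1
      rw [Finset.mem_range] at this; omega
    rw [mul_left_comm, hD, mul_neg, neg_neg, Nat.cast_sub hk',
      show z₁ - (z₂ + τ) = z₁ - z₂ - τ by ring]
    congr 3
    · congr 2; ring
    · congr 2; ring

lemma intTheta_eq (N : ℕ) (τ z₁ z₂ : ℂ) :
    intTheta N τ z₁ z₂ = ee (-(N : ℂ) ^ 2 * (z₁ - z₂) / (2 * (N + 1)) + τ * N ^ 2 / (4 * (N + 1)))
      * halfTheta N τ z₁ (z₂ + τ) := by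
  have hN1 : (N : ℂ) + 1 ≠ 0 := by exact_mod_cast N.succ_ne_zero
  rw [intTheta, halfTheta, thetaMinus_eq hN1, thetaMinus_eq hN1, ← mul_assoc, ← ee_add]
  congr 1
  · congr 1; field_simp; ring
  · refine tsum_congr fun j => ?_
    congr 2; field_simp; ring

lemma thetaMinus_first_translate (N : ℕ) (τ z₁ z₂ : ℂ) :
    thetaMinus N (N + 1) τ ((z₁ - z₂) / (N + 1) + z₁ + z₂)
      = ee (N * (z₁ - z₂ + (N + 1) * (z₁ + z₂)) / (2 * (N + 1)) + τ * N ^ 2 / (4 * (N + 1)))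
        * thetaMinus 0 (N + 1) τ ((z₁ - (z₂ + τ)) / (N + 1) + z₁ + (z₂ + τ)) := by
  have hN1 : (N : ℂ) + 1 ≠ 0 := by exact_mod_cast N.succ_ne_zero
  rw [thetaMinus_eq hN1, thetaMinus_eq hN1, ← mul_assoc, ← ee_add]
  congr 1
  · congr 1; field_simp; ring
  · refine tsum_congr fun j => ?_
    congr 2; field_simp; ring

lemma thetaMinus_second_translate (N : ℕ) (τ z₁ z₂ : ℂ) :
    thetaMinus 0 (N + 1) τ ((z₁ - (z₂ + τ)) / (N + 1) - z₁ - (z₂ + τ))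
      = -(ee (z₁ - z₂ - (N + 1) * (z₁ + z₂) - τ - (N * (z₁ - z₂ - (N + 1) * (z₁ + z₂)) / (2 * (N + 1))
          + τ * N ^ 2 / (4 * (N + 1))))
        * thetaMinus N (N + 1) τ ((z₁ - z₂) / (N + 1) - z₁ - z₂)) := by
  have hN1 : (N : ℂ) + 1 ≠ 0 := by exact_mod_cast N.succ_ne_zero
  rw [thetaMinus_eq hN1, thetaMinus_eq hN1, ← mul_assoc, ← ee_add, ← tsum_mul_left, ← tsum_mul_left,
    ← tsum_neg, ← (Equiv.addRight (1 : ℤ)).tsum_eq]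
  refine tsum_congr fun j => ?_
  rw [Equiv.coe_addRight, zpow_add₀ (by norm_num), zpow_one, mul_left_comm, ← ee_add,
    mul_left_comm (ee _), ← ee_add, mul_neg_one, neg_mul]
  congr 3
  push_cast
  field_simp
  ring

lemma vartheta11_translate (τ z : ℂ) :
    vartheta11 (2 * τ) (2 * (z + τ)) = -(ee (-(2 * z) - τ) * vartheta11 (2 * τ) (2 * z)) := by
  rw [mul_add, vartheta11_add_tau, neg_mul]
  congr 4; ring

lemma intRegular_translate {N : ℕ} {τ z₁ z₂ : ℂ} (h : IntRegular N τ z₁ z₂) :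
    HalfRegular N τ z₁ (z₂ + τ) := by
  refine ⟨?_, h.2.1, ?_⟩
  · have := h.1
    rw [intTheta_eq] at this
    exact right_ne_zero_of_mul this
  · rw [vartheta11_translate]
    exact neg_ne_zero.mpr (mul_ne_zero (ee_ne_zero _) h.2.2)

/-- The translation `z₂ ↦ z₂ + τ` multiplies every theta function by an exponential. After division
by `intTheta` all of these combine to the single factor `ee (N * z₁)`. -/
lemma intFormula_eq {N : ℕ} (hN : Odd N) {τ z₁ z₂ : ℂ} (h : IntRegular N τ z₁ z₂) :
    intFormula N τ z₁ z₂ = ee (N * z₁) * halfFormula N τ z₁ (z₂ + τ)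
      + ∑ k ∈ Finset.Icc 1 ((N - 1) / 2), shiftTerm N k (2 * τ) (2 * z₁) (2 * z₂) := by
  have hN' : (N : ℂ) ≠ 0 := by exact_mod_cast hN.pos.ne'
  have hN1 : (N : ℂ) + 1 ≠ 0 := by exact_mod_cast N.succ_ne_zero
  rw [intFormula]
  congr 1
  · have hθ := (intRegular_translate h).1
    have hv := h.2.2
    have hseries : ∑' j : ℕ, intTerm N τ z₁ z₂ j = ee (N * (z₁ + z₂) / 2 + N * τ / 4) *
        ∑' j : ℕ, halfTerm N τ z₁ (z₂ + τ) j := by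
      simp only [intTerm_eq hN, tsum_mul_left]
    have hexp : cexp ((Real.pi : ℂ) * I * N / (N + 1) * (z₁ - z₂))
        = ee (N * (z₁ - z₂) / (2 * (N + 1))) := by
      rw [ee]; congr 1; field_simp
    set C := ee (-(N : ℂ) ^ 2 * (z₁ - z₂) / (2 * (N + 1)) + τ * N ^ 2 / (4 * (N + 1))) with hC
    have hC0 : C ≠ 0 := ee_ne_zero _
    have e1 : ee (N * (z₁ - z₂ + (N + 1) * (z₁ + z₂)) / (2 * (N + 1)) + τ * N ^ 2 / (4 * (N + 1)))
        = C * ee (N * z₁) := by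
      rw [hC, ← ee_add]; congr 1; field_simp; ring
    have e2 : qPow τ (-(N / (4 * (N + 1)))) * ee (N * (z₁ - z₂) / (2 * (N + 1)))
        * ee (N * (z₁ + z₂) / 2 + N * τ / 4) = C * ee (N * z₁) := by
      rw [hC, qPow_eq, ← ee_add, ← ee_add, ← ee_add]; congr 1; field_simp; ring
    have e3 : C * ee (N * z₁) * ee (z₁ - z₂ - (N + 1) * (z₁ + z₂) - τ
        - (N * (z₁ - z₂ - (N + 1) * (z₁ + z₂)) / (2 * (N + 1)) + τ * N ^ 2 / (4 * (N + 1))))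
        = ee (-(2 * z₂) - τ) := by
      rw [hC, ← ee_add, ← ee_add]; congr 1; field_simp; ring
    rw [hexp, hseries, intTheta_eq, ← hC, halfFormula, thetaMinus_first_translate, e1,
      thetaMinus_second_translate, vartheta11_translate, ← mul_assoc, e2]
    set A := thetaMinus 0 (N + 1) τ ((z₁ - (z₂ + τ)) / (N + 1) + z₁ + (z₂ + τ))
    set B := thetaMinus N (N + 1) τ ((z₁ - z₂) / (N + 1) - z₁ - z₂)
    set E := ee (z₁ - z₂ - (N + 1) * (z₁ + z₂) - τ
        - (N * (z₁ - z₂ - (N + 1) * (z₁ + z₂)) / (2 * (N + 1)) + τ * N ^ 2 / (4 * (N + 1))))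
    have hB : B / vartheta11 (2 * τ) (2 * z₂) = C * ee (N * z₁) *
        (-(E * B) / -(ee (-(2 * z₂) - τ) * vartheta11 (2 * τ) (2 * z₂))) := by
      rw [← e3]
      have h1 : E ≠ 0 := ee_ne_zero _
      have h2 := ee_ne_zero (N * z₁)
      field_simp
    rw [hB]
    field_simp
  · refine Finset.sum_congr rfl fun k _ => ?_
    rw [shiftTerm, qPow_eq, qPow_eq]
    congr 2
    · congr 1; ring
    · congr 1; field_simp

lemma intFormula_eq_Phi {N : ℕ} (hN : Odd N) {τ z₁ z₂ : ℂ} (hτ : 0 < τ.im)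
    (h : IntRegular N τ z₁ z₂) :
    intFormula N τ z₁ z₂ = Phi (N / 2) 0 (2 * τ) (2 * z₁) (2 * z₂) 0 := by
  obtain ⟨hz₁, hz₂⟩ := intRegular_offLattice hτ h
  have hτ' : 0 < (2 * τ).im := by simpa using hτ
  rw [intFormula_eq hN h, halfFormula_eq_Phi hN.pos hτ (intRegular_translate h), ← Phi_translate]
  obtain ⟨n, rfl⟩ := hN
  have hs := Phi_add_int (N := 2 * n + 1) (by omega) 0 (n + 1) hτ' hz₁ hz₂
  rw [Finset.Ico_eq_empty (a := (n : ℤ) + 1) (by omega), Finset.sum_empty, add_zero] at hs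
  have hc : (((2 * n + 1 : ℕ) : ℂ) + 1) / 2 = 0 + ((n + 1 : ℤ) : ℂ) := by push_cast; ring
  rw [hc, hs]
  have hsum := sum_range_add_int
    (fun k : ℤ => shiftTerm (2 * n + 1) (0 + k) (2 * τ) (2 * z₁) (2 * z₂)) 0 (n + 1)
  rw [zero_add, Nat.cast_add, Nat.cast_one] at hsum
  rw [← hsum, Finset.sum_range_succ']
  -- Going from `s = (N+1)/2` down to `0` produces shift terms for `0 ≤ k ≤ (N-1)/2`; that for `k =
  -- 0` vanishes because `D_0 = 0`, so the sum in `intFormula` starts at `1`.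
  have h0 : shiftTerm (2 * n + 1) (0 + (((0 : ℕ) : ℤ) + 0 : ℤ)) (2 * τ) (2 * z₁) (2 * z₂) = 0 := by
    rw [shiftTerm]; simp [thetaDiff_zero]
  have h1 : ∑ k ∈ Finset.Icc 1 ((2 * n + 1 - 1) / 2), shiftTerm (2 * n + 1) (k : ℂ) (2 * τ) (2 * z₁) (2 * z₂)
      = ∑ k ∈ Finset.range n, shiftTerm (2 * n + 1) ((k + 1 : ℕ) : ℂ) (2 * τ) (2 * z₁) (2 * z₂) := by
    refine (Finset.sum_nbij' (fun k => k + 1) (fun k => k - 1) ?_ ?_ ?_ ?_ ?_).symm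
    · intro k hk; simp only [Finset.mem_Icc, Finset.mem_range] at *; omega
    · intro k hk; simp only [Finset.mem_Icc, Finset.mem_range] at *; omega
    · intro k _; omega
    · intro k hk; simp only [Finset.mem_Icc] at hk; omega
    · intro k _; rfl
  rw [h0, h1]
  simp

lemma summable_intTerm {N : ℕ} (hN : Odd N) {τ : ℂ} (hτ : 0 < τ.im) (z₁ z₂ : ℂ) :
    Summable (intTerm N τ z₁ z₂) := by
  have h := (hasSum_halfTerm hN.pos hτ z₁ (z₂ + τ)).summable.mul_left
    (ee (N * (z₁ + z₂) / 2 + N * τ / 4))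
  exact h.congr fun j => (intTerm_eq hN τ z₁ z₂ j).symm

/-! ### The formula on the domain -/

lemma offLattice_of_nat_mul {τ z : ℂ} (c : ℕ) (h : OffLattice (c * τ) (c * z)) : OffLattice τ z :=
  fun a b hz => h (c * a) b (by rw [hz]; push_cast; ring)

lemma offLattice_two_pow_of_le {τ z : ℂ} {i p : ℕ} (hi : i ≤ p)
    (h : OffLattice (2 ^ p * τ) (2 ^ p * z)) : OffLattice (2 ^ i * τ) (2 ^ i * z) := by
  refine offLattice_of_nat_mul (2 ^ (p - i)) ?_
  push_cast
  rwa [← mul_assoc, ← mul_assoc, ← pow_add, Nat.sub_add_cancel hi]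

lemma Phi_iterated_duplication {N : ℕ} (hN : 0 < N) {τ z₁ z₂ : ℂ} (hτ : 0 < τ.im) {q : ℕ}
    (hq : 2 ^ q ∣ N) (hz₁ : OffLattice (2 ^ q * τ) (2 ^ q * z₁))
    (hz₂ : OffLattice (2 ^ q * τ) (2 ^ q * z₂)) :
    Phi (N / 2) 0 τ z₁ z₂ 0
      = Phi ((N / 2 ^ q : ℕ) / 2) 0 (2 ^ q * τ) (2 ^ q * z₁) (2 ^ q * z₂) 0
        + ∑ i ∈ Finset.range q, Phi ((N / 2 ^ (i + 1) : ℕ) / 2) (1 / 2) (2 * (2 ^ i * τ))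
          (2 * (2 ^ i * z₁)) (2 * (2 ^ i * z₂)) 0 := by
  induction q with
  | zero => simp
  | succ q ih =>
    have hsucc : ∀ w : ℂ, 2 ^ (q + 1) * w = 2 * (2 ^ q * w) := fun w => by ring
    have hdvd : 2 ^ q ∣ N := (pow_dvd_pow 2 q.le_succ).trans hq
    rw [ih hdvd (offLattice_two_pow_of_le q.le_succ hz₁) (offLattice_two_pow_of_le q.le_succ hz₂),
      Finset.sum_range_succ]
    rw [hsucc, hsucc] at hz₁ hz₂
    obtain ⟨M, hM⟩ := hq
    have h1 : N / 2 ^ (q + 1) = M := by rw [hM]; exact Nat.mul_div_cancel_left _ (by positivity)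
    have h2 : N / 2 ^ q = 2 * M := by
      rw [hM, pow_succ, mul_assoc]; exact Nat.mul_div_cancel_left _ (by positivity)
    have hM0 : 0 < M := Nat.pos_of_ne_zero fun h0 => by simp [h0] at hM; omega
    have h3 : (((2 * M : ℕ) : ℂ)) / 2 = M := by push_cast; ring
    rw [h2, h3, Phi_duplication hM0 (two_pow_mul_im_pos hτ q) hz₁ hz₂, h1, hsucc, hsucc, hsucc]
    ring

lemma odd_div_two_pow {N : ℕ} (hN : 0 < N) : Odd (N / 2 ^ padicValNat 2 N) := by
  rw [← Nat.not_even_iff_odd, even_iff_two_dvd]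
  rintro ⟨M, hM⟩
  have h : N = 2 ^ padicValNat 2 N * (N / 2 ^ padicValNat 2 N) :=
    (Nat.mul_div_cancel' pow_padicValNat_dvd).symm
  refine pow_succ_padicValNat_not_dvd (p := 2) hN.ne' ⟨M, ?_⟩
  rw [pow_succ, mul_assoc, ← hM, ← h]

lemma baseFormula_eq_Phi {N : ℕ} (hN : 0 < N) (S : ℤ) {τ z₁ z₂ : ℂ} (hτ : 0 < τ.im)
    (h : (z₁, z₂) ∈ explicitDomain N S τ) :
    OffLattice τ z₁ ∧ OffLattice τ z₂ ∧
      baseFormula N S τ z₁ z₂ = Phi (N / 2) (((S % 2 : ℤ) : ℂ) / 2) τ z₁ z₂ 0 := by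
  have h2 : ∀ w : ℂ, 2 * (w / 2) = w := fun w => by ring
  by_cases hS : Even S
  · simp only [explicitDomain, hS, if_true, Set.mem_ofPred_eq] at h
    simp only [baseFormula, hS, if_true]
    set p := padicValNat 2 N
    obtain ⟨h0, hi⟩ := h
    have hτp := two_pow_mul_div_two_im_pos hτ p
    obtain ⟨hz₁, hz₂⟩ := intRegular_offLattice hτp h0
    have hf := intFormula_eq_Phi (odd_div_two_pow hN) hτp h0
    simp only [h2] at hz₁ hz₂ hf
    have hz₁' := offLattice_two_pow_of_le (Nat.zero_le p) hz₁
    have hz₂' := offLattice_two_pow_of_le (Nat.zero_le p) hz₂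
    simp only [pow_zero, one_mul] at hz₁' hz₂'
    refine ⟨hz₁', hz₂', ?_⟩
    rw [Int.even_iff.mp hS, Int.cast_zero, zero_div,
      Phi_iterated_duplication hN hτ pow_padicValNat_dvd hz₁ hz₂, hf]
    congr 1
    refine Finset.sum_congr rfl fun i hi' => ?_
    exact halfFormula_eq_Phi (div_two_pow_pos hN (Finset.mem_range.mp hi'))
      (two_pow_mul_im_pos hτ i) (hi i hi')
  · simp only [explicitDomain, hS, if_false, Set.mem_ofPred_eq] at h
    simp only [baseFormula, hS, if_false]
    have hτ2 : 0 < (τ / 2).im := by simpa using two_pow_mul_div_two_im_pos hτ 0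
    obtain ⟨hz₁, hz₂⟩ := halfRegular_offLattice hτ2 h
    have hf := halfFormula_eq_Phi hN hτ2 h
    simp only [h2] at hz₁ hz₂ hf
    refine ⟨hz₁, hz₂, ?_⟩
    rw [hf, Int.odd_iff.mp (Int.not_even_iff_odd.mp hS), Int.cast_one]

lemma Phi_eq_explicitPhi {N : ℕ} (hN : 0 < N) (S : ℤ) {τ z₁ z₂ : ℂ} (t : ℂ) (hτ : 0 < τ.im)
    (h : (z₁, z₂) ∈ explicitDomain N S τ) :
    Phi (N / 2) (S / 2) τ z₁ z₂ t = explicitPhi N S τ z₁ z₂ t := by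
  obtain ⟨hz₁, hz₂, hb⟩ := baseFormula_eq_Phi hN S hτ h
  have hS : (S : ℂ) / 2 = ((S % 2 : ℤ) : ℂ) / 2 + ((S / 2 : ℤ) : ℂ) := by
    have := congrArg (Int.cast : ℤ → ℂ) (Int.emod_add_mul_ediv S 2)
    push_cast at this
    linear_combination -this / 2
  have ht : cexp (-((Real.pi : ℂ) * I * N * t)) = ee (-(N / 2 * t)) := by
    rw [ee]; congr 1; ring
  rw [Phi_eq_mul_Phi_zero, explicitPhi, hb, hS, Phi_add_int hN _ _ hτ hz₁ hz₂, ht]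

/-! ### Continuity -/

lemma continuousAt_tsum_phi1Term {N : ℕ} (hN : 0 < N) (s : ℂ) {τ : ℂ} (hτ : 0 < τ.im) {z : ℂ × ℂ}
    (hz : OffLattice τ z.1) :
    ContinuousAt (fun w : ℂ × ℂ => ∑' j : ℤ, phi1Term (N / 2) s τ w.1 w.2 j) z := by
  have hN1 : (0 : ℝ) < N / 2 := by positivity
  obtain ⟨C, hC, hev⟩ := exists_eventually_norm_inv_one_sub_ee_le hτ hz
  have hev1 := continuousAt_fst.eventually hev
  -- Near `z` this `R` bounds the imaginary parts of both the coefficient of `j` and the constant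
  -- term in the exponent, which gives one Gaussian majorant for dominated convergence.
  set R : ℝ := |(N / 2 * (z.1 + z.2) + s * τ).im| + |(s * z.1).im| + 1 with hR
  have hev2 : ∀ᶠ w in 𝓝 z, |(N / 2 * (w.1 + w.2) + s * τ).im| < R := by
    have hc : ContinuousAt (fun w : ℂ × ℂ => |(N / 2 * (w.1 + w.2) + s * τ).im|) z := by fun_prop
    exact hc.eventually (gt_mem_nhds (by rw [hR]; linarith [abs_nonneg (s * z.1).im]))
  have hev3 : ∀ᶠ w in 𝓝 z, |(s * w.1).im| < R := by
    have hc : ContinuousAt (fun w : ℂ × ℂ => |(s * w.1).im|) z := by fun_prop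
    exact hc.eventually (gt_mem_nhds (by
      rw [hR]; linarith [abs_nonneg (N / 2 * (z.1 + z.2) + s * τ).im]))
  refine tendsto_tsum_of_dominated_convergence (bound := fun j : ℤ =>
    Real.exp (2 * Real.pi * R) * C * Real.exp (-(2 * Real.pi * τ.im * (N / 2) * (j : ℝ) ^ 2)
      + 2 * Real.pi * R * |(j : ℝ)|)) ((summable_gauss (by positivity) _).mul_left _)
    (fun j => ?_) ?_
  · have hd := ee_add_int_mul_ne_one hz j
    simp only [phi1Term_eq]
    have h1 : ContinuousAt (fun w : ℂ × ℂ => ee (N / 2 * j * (w.1 + w.2) + s * w.1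
      + τ * (N / 2 * (j : ℂ) ^ 2 + s * j))) z := by fun_prop
    have h2 : ContinuousAt (fun w : ℂ × ℂ => 1 - ee (w.1 + j * τ)) z := by fun_prop
    exact h1.div h2 hd
  · filter_upwards [hev1, hev2, hev3] with w h1 h2 h3 j
    rw [phi1Term_eq, div_eq_mul_inv, norm_mul]
    have hn : ‖ee (N / 2 * j * (w.1 + w.2) + s * w.1 + τ * (N / 2 * (j : ℂ) ^ 2 + s * j))‖
        ≤ Real.exp (2 * Real.pi * R) * Real.exp (-(2 * Real.pi * τ.im * (N / 2) * (j : ℝ) ^ 2)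
          + 2 * Real.pi * R * |(j : ℝ)|) := by
      rw [norm_ee, ← Real.exp_add]
      refine Real.exp_le_exp.mpr ?_
      have him : (N / 2 * j * (w.1 + w.2) + s * w.1 + τ * (N / 2 * (j : ℂ) ^ 2 + s * j)).im
          = τ.im * (N / 2 * (j : ℝ) ^ 2) + j * (N / 2 * (w.1 + w.2) + s * τ).im + (s * w.1).im := by
        have : N / 2 * j * (w.1 + w.2) + s * w.1 + τ * (N / 2 * (j : ℂ) ^ 2 + s * j)
            = ((N / 2 * (j : ℝ) ^ 2 : ℝ) : ℂ) * τ + ((j : ℝ) : ℂ) * (N / 2 * (w.1 + w.2) + s * τ)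
              + s * w.1 := by push_cast; ring
        rw [this, Complex.add_im, Complex.add_im, Complex.im_ofReal_mul, Complex.im_ofReal_mul]
        ring
      rw [him]
      have e1 : -((j : ℝ) * (N / 2 * (w.1 + w.2) + s * τ).im) ≤ R * |(j : ℝ)| := by
        refine (neg_le_abs _).trans ?_
        rw [abs_mul, mul_comm]
        gcongr
      have e2 : -(s * w.1).im ≤ R := (neg_le_abs _).trans h3.le
      have hp := Real.pi_pos
      nlinarith [mul_le_mul_of_nonneg_left (add_le_add e1 e2) (by positivity : 0 ≤ 2 * Real.pi)]
    calc _ ≤ _ := mul_le_mul hn (h1 j) (norm_nonneg _) (by positivity)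
      _ = _ := by ring

lemma continuousAt_Phi {N : ℕ} (hN : 0 < N) (s : ℂ) {τ : ℂ} (t : ℂ) (hτ : 0 < τ.im) {z : ℂ × ℂ}
    (hz₁ : OffLattice τ z.1) (hz₂ : OffLattice τ z.2) :
    ContinuousAt (fun w : ℂ × ℂ => Phi (N / 2) s τ w.1 w.2 t) z := by
  simp only [Phi_eq, phi2Term_eq_phi1Term]
  have h2 : ContinuousAt (fun w : ℂ × ℂ => ∑' j : ℤ, phi1Term (N / 2) s τ (-w.2) (-w.1) j) z := by
    have h := continuousAt_tsum_phi1Term hN s hτ (z := (-z.2, -z.1)) (offLattice_neg hz₂)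
    exact ContinuousAt.comp (f := fun w : ℂ × ℂ => (-w.2, -w.1)) h (by fun_prop)
  exact ((continuousAt_tsum_phi1Term hN s hτ hz₁).sub h2).const_mul _

end MockTheta

theorem mainTheorem10 (N : ℕ) (hN : 0 < N) (S : ℤ) (τ : ℂ) (hτ : 0 < τ.im) :
    -- the series defining `Φ` converge absolutely away from the poles
    (∀ z₁ z₂ : ℂ, MockTheta.OffLattice τ z₁ → MockTheta.OffLattice τ z₂ →
      Summable (MockTheta.phi1Term (N / 2) (S / 2) τ z₁ z₂) ∧
      Summable (MockTheta.phi2Term (N / 2) (S / 2) τ z₁ z₂)) ∧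
    -- the infinite series in the explicit formula converge absolutely
    (∀ z₁ z₂ : ℂ, Summable (MockTheta.halfTerm N τ z₁ z₂) ∧
      (Odd N → Summable (MockTheta.intTerm N τ z₁ z₂))) ∧
    -- the denominators of the explicit formula are nonzero on a dense set of `(z₁, z₂)`
    Dense (MockTheta.explicitDomain N S τ) ∧
    -- there the function `Φ` is given by the formula
    (∀ z₁ z₂ t : ℂ, (z₁, z₂) ∈ MockTheta.explicitDomain N S τ →
      MockTheta.OffLattice τ z₁ ∧ MockTheta.OffLattice τ z₂ ∧
      MockTheta.Phi (N / 2) (S / 2) τ z₁ z₂ t = MockTheta.explicitPhi N S τ z₁ z₂ t) ∧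
    -- at every other point where `Φ` is defined, its value is the limit of the formula
    (∀ z₁ z₂ t : ℂ, MockTheta.OffLattice τ z₁ → MockTheta.OffLattice τ z₂ →
      Tendsto (fun z : ℂ × ℂ => MockTheta.explicitPhi N S τ z.1 z.2 t)
        (𝓝[MockTheta.explicitDomain N S τ] (z₁, z₂))
        (𝓝 (MockTheta.Phi (N / 2) (S / 2) τ z₁ z₂ t))) := by
  refine ⟨fun z₁ z₂ h₁ h₂ => ⟨MockTheta.summable_phi1Term hN _ hτ h₁ z₂,
      MockTheta.summable_phi2Term hN _ hτ h₂ z₁⟩,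
    fun z₁ z₂ => ⟨(MockTheta.hasSum_halfTerm hN hτ z₁ z₂).summable,
      fun hodd => MockTheta.summable_intTerm hodd hτ z₁ z₂⟩,
    MockTheta.dense_explicitDomain hN S hτ,
    fun z₁ z₂ t h => ?_, fun z₁ z₂ t h₁ h₂ => ?_⟩
  · obtain ⟨hz₁, hz₂, -⟩ := MockTheta.baseFormula_eq_Phi hN S hτ h
    exact ⟨hz₁, hz₂, MockTheta.Phi_eq_explicitPhi hN S t hτ h⟩
  · have hc := MockTheta.continuousAt_Phi hN (S / 2) t hτ (z := (z₁, z₂)) h₁ h₂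
    refine (hc.tendsto.mono_left nhdsWithin_le_nhds).congr' ?_
    filter_upwards [self_mem_nhdsWithin] with w hw
    exact MockTheta.Phi_eq_explicitPhi hN S t hτ hw
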